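/- Let $N\ge 1$ and $r_0,\dots,r_N\in[0,1]$. Consider discrete-time birth and death processes $X$ on $\{0,\dots,N\}$ started at $X_0=0$, which step from $x$ to $x+1$ with probability $p_x$ and to $x-1$ with probability $q_x=1-p_x$, where $p_0=1$, $p_N=0$. The filtration $(\mathcal F_t)$ is generated by $X$ and by an exogenous sequence of i.i.d. signals (with an arbitrary law, independent of the moves), observed up to time $t$. A dynamic control $s$ consists of random ratios $w_x=q_x/p_x\in(0,\infty)$, $1\le x\le N-1$, where $w_x$ is measurable with respect to the information available at the time $T_x$ of the first visit to level $x$ and is frozen from then on: whenever the process is at $x$ it moves up with conditional probability $p_x=1/(1+w_x)$. Equivalently, $s$ is a random scale function with increments $\Delta s(k)=W_k=\prod_{j=1}^k w_j$, $0\le k\le N-1$ (so $W_0=1$). Let $\mathbb E^s$ be the expectation under the law of the process and the signals when control $s$ is used, $M_t=\max_{u\le t}X_u$, $T_N=\inf\{t: X_t=N\}$, and $S=\inf\{t>T_N: X_t=0\}$ the shuttle time. For a control $s_0$ let $\mathcal M^{s_0}_y$ be the set of all controls $s$ with $\Delta s=\Delta s_0$ on $\{0,\dots,y-1\}$. The Bellman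 process of the dynamic discounted problem is the adapted process $V^{s_0}$ with $$V^{s_0}_t=\operatorname*{ess\,sup}_{s\in\mathcal M^{s_0}_{M_t}}\mathbb E^s\Bigl[\prod_{u=0}^{S-1}r_{X_u}\Bigm|\mathcal F_t\Bigr],$$ i.e. on each event $\{M_t=y\}$ it is the essential supremum over $s\in\mathcal M^{s_0}_y$, with respect to the law under control $s_0$. Put $\sigma_i^2=(1-r_ir_{i+1})^{-1}$ for $0\le i\le N-1$ (with $1/\sigma_i=0$ if $r_ir_{i+1}=1$). For the scale increments $W$ of $s_0$ attach to a list of levels $u_1,u_2,\ldots$ and $v_1,v_2,\ldots$ the weight $\prod_m W_{v_m}\prod_m \frac{1}{\sigma_{u_m}^2W_{u_m}}$ (the empty list has weight $1$), and let * $\mathcal G(x)$ be the sum of the weights of all chains $0\le u_1<v_1<\dots<u_k<v_k<x$, $k\ge0$; * $\tilde{\mathcal G}(x)$ the sum over all chains $x\le v_1<u_1<\dots<v_k<u_k<N$, $k\ge0$; * $\tilde{\mathcal G}^*(y)$ the sum over all chains $0\le v_1<u_1<\dots<v_k<u_k<y$, $k\ge0$; * $\Delta\mathcal G(y)$ the sum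 over all chains $0\le u_1<v_1<\dots<v_{k-1}<u_k<y$, $k\ge1$; * $\Delta\tilde{\mathcal G}^*(y)$ the sum over all chains $0\le v_1<u_1<\dots<u_{k-1}<v_k<y$, $k\ge1$; * $A_k(y)=\sum_{y\le x_1<\dots<x_k<N}\prod_{m=1}^k\sigma_{x_m}^{-1}$, and $$\hat\psi(y)=\Bigl(\sqrt{\mathcal G(y)\tilde{\mathcal G}^*(y)}\sum_{n\ge0}A_{2n}(y)+\sqrt{\Delta\mathcal G(y)\,\Delta\tilde{\mathcal G}^*(y)}\sum_{n\ge0}A_{2n+1}(y)\Bigr)^{-2}.$$ Then for every dynamic control $s_0$ and every $t\ge0$, almost surely under the law with control $s_0$, $$V^{s_0}_t=\begin{cases}\Bigl(\prod_{u=0}^{t-1}r_{X_u}\Bigr)\Bigl(\prod_{i=X_t}^{N-1}r_i\Bigr)\Bigl(\prod_{i=1}^{N}r_i\Bigr)\mathcal G(X_t)\,\hat\psi(M_t)&\text{if }M_t<N,\\[2mm] \Bigl(\prod_{u=0}^{t\wedge S-1}r_{X_u}\Bigr)\Bigl(\prod_{i=1}^{X_{t\wedge S}}r_i\Bigr)\dfrac{\tilde{\mathcal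 G}(X_{t\wedge S})}{\tilde{\mathcal G}(0)}&\text{if }M_t=N.\end{cases}$$ -/

import Mathlib

open MeasureTheory ProbabilityTheory
open scoped ENNReal

namespace Shuttle

noncomputable section

/-! ### Path space, filtration, running maximum, shuttle time -/

/-- What is observed at one time instant: an exogenous signal in `E` (it carries whatever
information the filtration contains beyond the path of the process) and the position of the
birth and death process in `{0, …, N}`. -/
abbrev Obs (N : ℕ) (E : Type*) : Type _ := E × Fin (N + 1)

/-- Histories up to and including time `n`. -/
abbrev Hist (N : ℕ) (E : Type*) (n : ℕ) : Type _ := (_ : Finset.Iic n) → Obs N E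

/-- Infinite trajectories. -/
abbrev Path (N : ℕ) (E : Type*) : Type _ := (_ : ℕ) → Obs N E

/-- The position `X_n`. -/
def pos {N : ℕ} {E : Type*} (n : ℕ) (ω : Path N E) : ℕ := ((ω n).2 : ℕ)

/-- The filtration `ℱ_n` generated by the observations up to time `n`. -/
def filt (N : ℕ) (E : Type*) [MeasurableSpace E] :
    Filtration ℕ (MeasurableSpace.pi : MeasurableSpace (Path N E)) :=
  Filtration.piLE (X := fun _ : ℕ => Obs N E)

/-- The event `{T_x = n}`: level `x` is visited for the first time at time `n`. -/
def firstVisit {N : ℕ} {E : Type*} (x n : ℕ) : Set (Path N E) :=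
  {ω | pos n ω = x ∧ ∀ m < n, pos m ω ≠ x}

/-- The running maximum `M_n = max_{m ≤ n} X_m`. -/
def runMax {N : ℕ} {E : Type*} (n : ℕ) (ω : Path N E) : ℕ :=
  (Finset.range (n + 1)).sup fun m => pos m ω

/-- The shuttle time `S`: the first time at `0` after a visit to `N` (`⊤` if there is none). -/
def shuttleTime {N : ℕ} {E : Type*} (ω : Path N E) : ℕ∞ :=
  sInf {k : ℕ∞ | ∃ n : ℕ, k = n ∧ pos n ω = 0 ∧ ∃ m < n, pos m ω = N}

/-- The discount `∏_{u < n ∧ S} r_{X_u}`. -/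
def discount {N : ℕ} {E : Type*} (r : ℕ → ℝ) (n : ℕ) (ω : Path N E) : ℝ :=
  ∏ u ∈ (Finset.range n).filter (fun u : ℕ => (u : ℕ∞) < shuttleTime ω), r (pos u ω)

/-- The payoff `∏_{u < S} r_{X_u}`, an infinite product (limit of the decreasing partial
products) if `S = ∞`. -/
def payoff {N : ℕ} {E : Type*} (r : ℕ → ℝ) (ω : Path N E) : ℝ :=
  ⨅ n : ℕ, discount r n ω

/-! ### Controls and the law of the controlled process -/

/-- A dynamic control: at the first visit to level `x` the controller chooses the ratio
`w x = q_x / p_x > 0`, on the basis of the information available at that time; the choice is then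
frozen. Equivalently, the control is an adapted random scale function. -/
structure Control (N : ℕ) (E : Type*) [MeasurableSpace E] where
  /-- the ratio `q_x / p_x` -/
  w : ℕ → Path N E → ℝ
  pos_w : ∀ x ω, 0 < w x ω
  measurable_w : ∀ x, Measurable (w x)
  /-- `w x` is measurable with respect to the information at the first visit to `x` -/
  adapted_w : ∀ x n, Measurable[filt N E n] ((firstVisit x n).indicator (w x))

/-- The increments `Δs(k) = W_k = ∏_{j=1}^k w_j` of the random scale function. -/
def Control.W {N : ℕ} {E : Type*} [MeasurableSpace E] (s : Control N E) (ω : Path N E)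
    (k : ℕ) : ℝ :=
  ∏ j ∈ Finset.Icc 1 k, s.w j ω

/-- Extend a history to a trajectory by repeating its last observation. -/
def extend {N : ℕ} {E : Type*} {n : ℕ} (h : Hist N E n) : Path N E :=
  fun i => h ⟨min i n, Finset.mem_Iic.2 (min_le_right i n)⟩

lemma measurable_extend {N : ℕ} {E : Type*} [MeasurableSpace E] {n : ℕ} :
    Measurable (extend : Hist N E n → Path N E) :=
  measurable_pi_lambda _ fun _ => measurable_pi_apply _

/-- The position at the end of a history. -/
def lastPos {N : ℕ} {E : Type*} {n : ℕ} (h : Hist N E n) : Fin (N + 1) :=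
  (h ⟨n, Finset.mem_Iic.2 le_rfl⟩).2

lemma measurable_lastPos {N : ℕ} {E : Type*} [MeasurableSpace E] {n : ℕ} :
    Measurable (lastPos : Hist N E n → Fin (N + 1)) :=
  measurable_snd.comp (measurable_pi_apply _)

/-- The probability of an upward step after a history that ends at `x`: `1` at `x = 0`, `0` at
`x = N`, and `p_x = 1 / (1 + w_x)` otherwise. As `x` has been visited, `w_x` depends on the
history only. -/
def Control.up {N : ℕ} {E : Type*} [MeasurableSpace E] (s : Control N E) {n : ℕ}
    (h : Hist N E n) : ℝ :=
  if (lastPos h : ℕ) = 0 then 1 else if (lastPos h : ℕ) = N then 0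
  else 1 / (1 + s.w (lastPos h) (extend h))

lemma Control.measurable_up {N : ℕ} {E : Type*} [MeasurableSpace E] (s : Control N E) {n : ℕ} :
    Measurable (s.up : Hist N E n → ℝ) := by
  have key : Measurable fun q : Fin (N + 1) × Hist N E n =>
      if (q.1 : ℕ) = 0 then (1 : ℝ) else if (q.1 : ℕ) = N then 0
        else 1 / (1 + s.w q.1 (extend q.2)) := by
    refine measurable_from_prod_countable_right fun x => ?_
    have hx := (s.measurable_w x).comp (measurable_extend (N := N) (E := E) (n := n))
    by_cases h0 : (x : ℕ) = 0
    · simp only [h0, if_true]; exact measurable_const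
    · by_cases hN : (x : ℕ) = N
      · simp only [hN, if_true]; exact measurable_const
      · simp only [h0, hN, if_false]
        exact measurable_const.div (measurable_const.add hx)
  exact key.comp (measurable_lastPos.prodMk measurable_id)

lemma Control.up_mem {N : ℕ} {E : Type*} [MeasurableSpace E] (s : Control N E) {n : ℕ}
    (h : Hist N E n) : 0 ≤ s.up h ∧ s.up h ≤ 1 := by
  have hw := s.pos_w (lastPos h) (extend h)
  unfold Control.up
  split_ifs
  · simp
  · simp
  · exact ⟨by positivity, by rw [div_le_one (by positivity)]; linarith⟩

/-- One step up (cut off at `N`; a step up from `N` has probability `0`). -/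
def above {N : ℕ} (x : Fin (N + 1)) : Fin (N + 1) :=
  ⟨min ((x : ℕ) + 1) N, Nat.lt_succ_of_le (min_le_right _ _)⟩

/-- One step down (cut off at `0`; a step down from `0` has probability `0`). -/
def below {N : ℕ} (x : Fin (N + 1)) : Fin (N + 1) :=
  ⟨(x : ℕ) - 1, lt_of_le_of_lt (Nat.sub_le _ _) x.2⟩

/-- The conditional law of the next position given the history. -/
def Control.move {N : ℕ} {E : Type*} [MeasurableSpace E] (s : Control N E) (n : ℕ) :
    Kernel (Hist N E n) (Fin (N + 1)) where
  toFun h := ENNReal.ofReal (s.up h) • Measure.dirac (above (lastPos h)) +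
    ENNReal.ofReal (1 - s.up h) • Measure.dirac (below (lastPos h))
  measurable' := by
    have hu := s.measurable_up (n := n)
    have hd : ∀ f : Fin (N + 1) → Fin (N + 1),
        Measurable fun h : Hist N E n => Measure.dirac (f (lastPos h)) := fun f =>
      Measure.measurable_dirac.comp ((measurable_of_countable f).comp measurable_lastPos)
    refine Measure.measurable_of_measurable_coe _ fun A hA => ?_
    simp only [Measure.coe_add, Measure.coe_smul, Pi.add_apply, Pi.smul_apply, smul_eq_mul]
    exact (hu.ennreal_ofReal.mul ((Measure.measurable_coe hA).comp (hd above))).add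
      ((measurable_const.sub hu).ennreal_ofReal.mul ((Measure.measurable_coe hA).comp (hd below)))

instance {N : ℕ} {E : Type*} [MeasurableSpace E] (s : Control N E) (n : ℕ) :
    IsMarkovKernel (s.move n) := by
  refine ⟨fun h => ⟨?_⟩⟩
  have hu := s.up_mem h
  change (ENNReal.ofReal (s.up h) • Measure.dirac (above (lastPos h)) +
    ENNReal.ofReal (1 - s.up h) • Measure.dirac (below (lastPos h)) : Measure _) Set.univ = 1
  simp only [Measure.coe_add, Measure.coe_smul, Pi.add_apply, Pi.smul_apply, smul_eq_mul,
    measure_univ, mul_one]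
  rw [← ENNReal.ofReal_add hu.1 (by linarith [hu.2])]
  simp

/-- The conditional law of the next observation given the history: the signal has law `ν` and is
independent of the past and of the next position. -/
def Control.step {N : ℕ} {E : Type*} [MeasurableSpace E] (ν : Measure E) [IsProbabilityMeasure ν]
    (s : Control N E) (n : ℕ) : Kernel (Hist N E n) (Obs N E) :=
  Kernel.const (Hist N E n) ν ×ₖ s.move n

instance {N : ℕ} {E : Type*} [MeasurableSpace E] (ν : Measure E) [IsProbabilityMeasure ν]
    (s : Control N E) (n : ℕ) : IsMarkovKernel (s.step ν n) := by
  unfold Control.step; infer_instance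

/-- The law `P^s` of the controlled process `X^s`, started at `0`. -/
def Control.law {N : ℕ} {E : Type*} [MeasurableSpace E] (ν : Measure E) [IsProbabilityMeasure ν]
    (s : Control N E) : Measure (Path N E) :=
  Kernel.trajMeasure (X := fun _ : ℕ => Obs N E) (ν.prod (Measure.dirac (0 : Fin (N + 1))))
    (s.step ν)

instance {N : ℕ} {E : Type*} [MeasurableSpace E] (ν : Measure E) [IsProbabilityMeasure ν]
    (s : Control N E) : IsProbabilityMeasure (s.law ν) := by
  unfold Control.law; infer_instance

/-! ### The Bellman process -/

/-- The constrained control set `ℳ_y^{s₀}`: controls whose scale function has the same increments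
as `s₀` on `{0, …, y - 1}`. -/
def constrained {N : ℕ} {E : Type*} [MeasurableSpace E] (s₀ : Control N E) (y : ℕ) :
    Set (Control N E) :=
  {s | ∀ k < y, ∀ ω, s.W ω k = s₀.W ω k}

/-- `V` is the `μ`-essential supremum of the family `f`. -/
structure IsEssSup {Ω ι : Type*} [MeasurableSpace Ω] (μ : Measure Ω) (f : ι → Ω → ℝ)
    (V : Ω → ℝ) : Prop where
  aemeasurable : AEMeasurable V μ
  le : ∀ i, f i ≤ᵐ[μ] V
  least : ∀ Z : Ω → ℝ, AEMeasurable Z μ → (∀ i, f i ≤ᵐ[μ] Z) → V ≤ᵐ[μ] Z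

/-- `V` is the Bellman process of the dynamic discounted problem for the control `s₀`: it is
adapted and
`V_t = esssup { E^s[∏_{u<S} r_{X_u} | ℱ_t] : s ∈ ℳ_y^{s₀} }` on the event `{M_t = y}`, i.e. with
`y = M_t`. -/
structure IsBellmanProcess {N : ℕ} {E : Type*} [MeasurableSpace E] (ν : Measure E)
    [IsProbabilityMeasure ν] (r : ℕ → ℝ) (s₀ : Control N E) (V : ℕ → Path N E → ℝ) : Prop where
  adapted : ∀ t, AEStronglyMeasurable[filt N E t] (V t) (s₀.law ν)
  isEssSup : ∀ t y : ℕ, y ≤ N →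
    IsEssSup ((s₀.law ν).restrict {ω | runMax t ω = y})
      (fun s : constrained s₀ y => (s.1.law ν)[payoff r | filt N E t]) (V t)

/-! ### The functions in the solution

Below `W` is a sequence of scale increments and `σ_i² = (1 - r_i r_{i+1})⁻¹`. In every term of the
series the factors `σ_{v}` cancel, so that only `W_v` and `σ_u⁻² / W_u` occur; this also gives the
terms their right meaning when `σ_i = ∞`. -/

/-- `σ_i⁻² = 1 - r_i r_{i+1}`. -/
def tau (r : ℕ → ℝ) (i : ℕ) : ℝ := 1 - r i * r (i + 1)

/-- The sum over all chains `a ≤ x₁ < x₂ < … < x_k < b` of the alternating product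
`α(x₁) β(x₂) α(x₃) ⋯`. A chain is given by the set of its elements. -/
def chainSum (α β : ℕ → ℝ) (k a b : ℕ) : ℝ :=
  ∑ c ∈ (Finset.Ico a b).powersetCard k,
    ∏ i ∈ c, if Even (c.filter (· < i)).card then α i else β i

/-- The weight `σ_u⁻² / W_u`. -/
def uWeight (r W : ℕ → ℝ) (i : ℕ) : ℝ := tau r i / W i

/-- `𝒢(x)`: the sum over chains `0 ≤ u₁ < v₁ < … < u_k < v_k < x`, `k ≥ 0`. -/
def calG (N : ℕ) (r W : ℕ → ℝ) (x : ℕ) : ℝ :=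
  ∑ k ∈ Finset.range (N + 1), chainSum (uWeight r W) W (2 * k) 0 x

/-- `𝒢̃(x)`: the sum over chains `x ≤ v₁ < u₁ < … < v_k < u_k < N`, `k ≥ 0`. -/
def tildeG (N : ℕ) (r W : ℕ → ℝ) (x : ℕ) : ℝ :=
  ∑ k ∈ Finset.range (N + 1), chainSum W (uWeight r W) (2 * k) x N

/-- `𝒢̃*(y)`: the sum over chains `0 ≤ v₁ < u₁ < … < v_k < u_k < y`, `k ≥ 0`. -/
def tildeGStar (N : ℕ) (r W : ℕ → ℝ) (y : ℕ) : ℝ :=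
  ∑ k ∈ Finset.range (N + 1), chainSum W (uWeight r W) (2 * k) 0 y

/-- `Δ𝒢(y)`: the sum over chains `0 ≤ u₁ < v₁ < … < v_k < u_{k+1} < y`, `k ≥ 0`. -/
def deltaG (N : ℕ) (r W : ℕ → ℝ) (y : ℕ) : ℝ :=
  ∑ k ∈ Finset.range (N + 1), chainSum (uWeight r W) W (2 * k + 1) 0 y

/-- `Δ𝒢̃*(y)`: the sum over chains `0 ≤ v₁ < u₁ < … < u_k < v_{k+1} < y`, `k ≥ 0`. -/
def deltaTildeGStar (N : ℕ) (r W : ℕ → ℝ) (y : ℕ) : ℝ :=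
  ∑ k ∈ Finset.range (N + 1), chainSum W (uWeight r W) (2 * k + 1) 0 y

/-- `A_k(y) = ∑_{y ≤ x₁ < … < x_k < N} ∏ σ_{x_m}⁻¹`. -/
def calA (N : ℕ) (r : ℕ → ℝ) (k y : ℕ) : ℝ :=
  ∑ c ∈ (Finset.Ico y N).powersetCard k, ∏ i ∈ c, √(tau r i)

/-- `ψ̂(y)`. -/
def psiHat (N : ℕ) (r W : ℕ → ℝ) (y : ℕ) : ℝ :=
  ((√(calG N r W y * tildeGStar N r W y) * ∑ k ∈ Finset.range (N + 1), calA N r (2 * k) y +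
    √(deltaG N r W y * deltaTildeGStar N r W y) *
      ∑ k ∈ Finset.range (N + 1), calA N r (2 * k + 1) y) ^ 2)⁻¹

/-- The stopped time `t ∧ S`. -/
def stopTime {N : ℕ} {E : Type*} (t : ℕ) (ω : Path N E) : ℕ :=
  (min (t : ℕ∞) (shuttleTime ω)).toNat

/-- The explicit candidate for the Bellman process. -/
def solution {N : ℕ} {E : Type*} [MeasurableSpace E] (r : ℕ → ℝ) (s₀ : Control N E) (t : ℕ)
    (ω : Path N E) : ℝ :=
  if runMax t ω < N then
    (∏ u ∈ Finset.range t, r (pos u ω)) *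
      ((∏ i ∈ Finset.Ico (pos t ω) N, r i) * (∏ i ∈ Finset.Icc 1 N, r i)) *
      calG N r (s₀.W ω) (pos t ω) * psiHat N r (s₀.W ω) (runMax t ω)
  else
    (∏ u ∈ Finset.range (stopTime t ω), r (pos u ω)) *
      (∏ i ∈ Finset.Icc 1 (pos (stopTime t ω) ω), r i) *
      (tildeG N r (s₀.W ω) (pos (stopTime t ω) ω) / tildeG N r (s₀.W ω) 0)

end

end Shuttle

/-!
Write `F(y) = ψ̂(y)^(-1/2) = √(𝒢 𝒢̃*) A_even + √(Δ𝒢 Δ𝒢̃*) A_odd` (`rootPsi`). The chain sums satisfy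
two-term recursions in their end point, of which two things follow.

* Whatever the ratios are, `preVal`, the product of `r` over the remaining way times `𝒢`, is
  harmonic for the discounted process on its way up, and `postVal`, built from `𝒢̃`, is harmonic on
  its way down (`preVal_balance`, `postVal_balance`). Hence the conditional mean of the candidate
  `V` at the next time differs from its present value only through the increase of the running
  maximum, namely by a nonnegative multiple of the increment of `ψ̂` (`stepMean_of_lt`).
* Choosing the scale increment `W_y` turns `F(y)` into `F(y + 1) ≥ F(y)`: this is the Cauchy–Schwarz
  inequality, applied to the even and to the odd part (`rootPsi_le_succ`). Both instances have the
  same defect, so one and the same `W_y` makes both nearly equalities (`rootPsi_succ_le`). The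
  optimal `W_y` may be `0` or `∞`, therefore the supremum need not be attained.

So `V` is a bounded supermartingale under every control. Under a nearly optimal control it becomes
a submartingale after multiplication by `c ^ (N - M_t)` with `c` close to `1` (`wsol`). The shuttle
time is almost surely finite by Lévy's Borel–Cantelli lemma (`ae_exists_shuttled`), and after it `V`
is the payoff; dominated convergence then bounds the conditional expectation of the payoff by
`V_t` from above for every control (`setIntegral_payoff_le`), and from below by `c ^ (N - M_t) V_t`
for the nearly optimal ones (`setIntegral_wsol_le_payoff`).

These bounds hold almost surely under the law of the control in question, whereas the essential
supremum refers to the law of `s₀`. They carry over since the laws of any two controls are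
equivalent on finite histories (`law_map_absolutelyContinuous`). A function of a path that only
depends on the visited levels is made measurable with respect to the history by evaluating it at
the path frozen at the present time (`freeze`); this changes nothing on nearest neighbour paths.
-/

namespace Shuttle

/-! ### Alternating chain sums -/

lemma chainSum_zero (α β : ℕ → ℝ) (a b : ℕ) : chainSum α β 0 a b = 1 := by
  simp [chainSum]

/-- Chains that do not use the last level `b`, and chains that do: then `b` is preceded by `k`
levels. -/
lemma chainSum_succ_right (α β : ℕ → ℝ) (k : ℕ) {a b : ℕ} (h : a ≤ b) :
    chainSum α β (k + 1) a (b + 1) =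
      chainSum α β (k + 1) a b + (if Even k then α b else β b) * chainSum α β k a b := by
  have hb : b ∉ Finset.Ico a b := by simp
  have hdisj : Disjoint ((Finset.Ico a b).powersetCard (k + 1))
      (((Finset.Ico a b).powersetCard k).image (insert b)) := by
    rw [Finset.disjoint_left]
    intro c hc hc'
    obtain ⟨d, -, rfl⟩ := Finset.mem_image.1 hc'
    exact hb ((Finset.mem_powersetCard.1 hc).1 (Finset.mem_insert_self _ _))
  have hI : Finset.Ico a (b + 1) = insert b (Finset.Ico a b) := by
    ext i; simp only [Finset.mem_Ico, Finset.mem_insert]; omega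
  unfold chainSum
  rw [hI, Finset.powersetCard_succ_insert hb, Finset.sum_union hdisj, Finset.sum_image,
    Finset.mul_sum]
  · congr 1
    refine Finset.sum_congr rfl fun c hc => ?_
    obtain ⟨hcs, hck⟩ := Finset.mem_powersetCard.1 hc
    have hbc : b ∉ c := fun h' => hb (hcs h')
    have hlt : ∀ i ∈ c, i < b := fun i hi => (Finset.mem_Ico.1 (hcs hi)).2
    rw [Finset.prod_insert hbc]
    congr 1
    · rw [Finset.filter_insert, if_neg (lt_irrefl b), Finset.filter_true_of_mem hlt, hck]
    · refine Finset.prod_congr rfl fun i hi => ?_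
      rw [Finset.filter_insert, if_neg (hlt i hi).le.not_gt]
  · intro c hc d hd hcd
    have hbc : b ∉ c := fun h' => hb ((Finset.mem_powersetCard.1 hc).1 h')
    have hbd : b ∉ d := fun h' => hb ((Finset.mem_powersetCard.1 hd).1 h')
    rw [← Finset.erase_insert hbc, ← Finset.erase_insert hbd, hcd]

/-- Chains that do not use the first level `a`, and chains that do: then the two weights swap
roles on the rest of the chain. -/
lemma chainSum_succ_left (α β : ℕ → ℝ) (k : ℕ) {a b : ℕ} (h : a < b) :
    chainSum α β (k + 1) a b =
      chainSum α β (k + 1) (a + 1) b + α a * chainSum β α k (a + 1) b := by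
  have ha : a ∉ Finset.Ico (a + 1) b := by simp
  have hdisj : Disjoint ((Finset.Ico (a + 1) b).powersetCard (k + 1))
      (((Finset.Ico (a + 1) b).powersetCard k).image (insert a)) := by
    rw [Finset.disjoint_left]
    intro c hc hc'
    obtain ⟨d, -, rfl⟩ := Finset.mem_image.1 hc'
    exact ha ((Finset.mem_powersetCard.1 hc).1 (Finset.mem_insert_self _ _))
  have hI : Finset.Ico a b = insert a (Finset.Ico (a + 1) b) := by
    ext i; simp only [Finset.mem_Ico, Finset.mem_insert]; omega
  unfold chainSum
  rw [hI, Finset.powersetCard_succ_insert ha, Finset.sum_union hdisj, Finset.sum_image,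
    Finset.mul_sum]
  · congr 1
    refine Finset.sum_congr rfl fun c hc => ?_
    obtain ⟨hcs, hck⟩ := Finset.mem_powersetCard.1 hc
    have hac : a ∉ c := fun h' => ha (hcs h')
    have hlt : ∀ i ∈ c, a < i := fun i hi => (Finset.mem_Ico.1 (hcs hi)).1
    rw [Finset.prod_insert hac]
    congr 1
    · rw [Finset.filter_insert, if_neg (lt_irrefl a),
        Finset.filter_false_of_mem fun i hi => (hlt i hi).le.not_gt]
      simp
    · refine Finset.prod_congr rfl fun i hi => ?_
      rw [Finset.filter_insert, if_pos (hlt i hi), Finset.card_insert_of_notMem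
        (fun h' => hac (Finset.mem_filter.1 h').1)]
      by_cases he : Even (c.filter (· < i)).card <;> simp [Nat.even_add_one, he]
  · intro c hc d hd hcd
    have hbc : a ∉ c := fun h' => ha ((Finset.mem_powersetCard.1 hc).1 h')
    have hbd : a ∉ d := fun h' => ha ((Finset.mem_powersetCard.1 hd).1 h')
    rw [← Finset.erase_insert hbc, ← Finset.erase_insert hbd, hcd]

lemma chainSum_eq_zero (α β : ℕ → ℝ) {k a b : ℕ} (h : b - a < k) : chainSum α β k a b = 0 := by
  unfold chainSum
  rw [Finset.powersetCard_eq_empty.2 (by simpa using h), Finset.sum_empty]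

lemma chainSum_nonneg {α β : ℕ → ℝ} {a b : ℕ} (hα : ∀ i < b, 0 ≤ α i) (hβ : ∀ i < b, 0 ≤ β i)
    (k : ℕ) : 0 ≤ chainSum α β k a b := by
  refine Finset.sum_nonneg fun c hc => Finset.prod_nonneg fun i hi => ?_
  have hib := (Finset.mem_Ico.1 ((Finset.mem_powersetCard.1 hc).1 hi)).2
  split_ifs
  exacts [hα i hib, hβ i hib]

lemma chainSum_congr {α α' β β' : ℕ → ℝ} {a b : ℕ} (hα : ∀ i < b, α i = α' i)
    (hβ : ∀ i < b, β i = β' i) (k : ℕ) : chainSum α β k a b = chainSum α' β' k a b := by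
  refine Finset.sum_congr rfl fun c hc => Finset.prod_congr rfl fun i hi => ?_
  have hib := (Finset.mem_Ico.1 ((Finset.mem_powersetCard.1 hc).1 hi)).2
  rw [hα i hib, hβ i hib]

lemma calA_eq_chainSum (N : ℕ) (r : ℕ → ℝ) (k y : ℕ) :
    calA N r k y = chainSum (fun i => √(tau r i)) (fun i => √(tau r i)) k y N := by
  simp [calA, chainSum]

/-- The sum of the chain sums of even length. For chains in an interval of at most `N` levels the
truncation of the sum is immaterial, see `chainSum_eq_zero`. -/
noncomputable def evenChains (N : ℕ) (α β : ℕ → ℝ) (a b : ℕ) : ℝ :=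
  ∑ k ∈ Finset.range (N + 1), chainSum α β (2 * k) a b

/-- The sum of the chain sums of odd length, truncated as in `evenChains`. -/
noncomputable def oddChains (N : ℕ) (α β : ℕ → ℝ) (a b : ℕ) : ℝ :=
  ∑ k ∈ Finset.range (N + 1), chainSum α β (2 * k + 1) a b

lemma evenChains_succ_right (α β : ℕ → ℝ) {N a b : ℕ} (h : a ≤ b) (hb : b ≤ N) :
    evenChains N α β a (b + 1) = evenChains N α β a b + β b * oddChains N α β a b := by
  unfold evenChains oddChains
  rw [Finset.sum_range_succ', Finset.sum_range_succ' (n := N)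
    (f := fun k => chainSum α β (2 * k) a b), Finset.sum_range_succ (n := N),
    chainSum_eq_zero (k := 2 * N + 1) α β (by omega)]
  simp only [mul_zero, chainSum_zero, add_zero, mul_add, mul_one]
  rw [Finset.mul_sum, add_right_comm, ← Finset.sum_add_distrib]
  congr 1
  refine Finset.sum_congr rfl fun k _ => ?_
  rw [show 2 * k + 2 = (2 * k + 1) + 1 from rfl, chainSum_succ_right α β _ h, if_neg (by simp)]

lemma oddChains_succ_right (N : ℕ) (α β : ℕ → ℝ) {a b : ℕ} (h : a ≤ b) :
    oddChains N α β a (b + 1) = oddChains N α β a b + α b * evenChains N α β a b := by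
  unfold evenChains oddChains
  rw [Finset.mul_sum, ← Finset.sum_add_distrib]
  refine Finset.sum_congr rfl fun k _ => ?_
  rw [chainSum_succ_right α β _ h, if_pos (by simp)]

lemma evenChains_succ_left (α β : ℕ → ℝ) {N a b : ℕ} (h : a < b) (hb : b ≤ N) :
    evenChains N α β a b = evenChains N α β (a + 1) b + α a * oddChains N β α (a + 1) b := by
  unfold evenChains oddChains
  rw [Finset.sum_range_succ', Finset.sum_range_succ' (n := N)
    (f := fun k => chainSum α β (2 * k) (a + 1) b), Finset.sum_range_succ (n := N),
    chainSum_eq_zero (k := 2 * N + 1) β α (by omega)]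
  simp only [mul_zero, chainSum_zero, add_zero, mul_add, mul_one]
  rw [Finset.mul_sum, add_right_comm, ← Finset.sum_add_distrib]
  congr 1
  refine Finset.sum_congr rfl fun k _ => ?_
  rw [show 2 * k + 2 = (2 * k + 1) + 1 from rfl, chainSum_succ_left α β _ h]

lemma oddChains_succ_left (N : ℕ) (α β : ℕ → ℝ) {a b : ℕ} (h : a < b) :
    oddChains N α β a b = oddChains N α β (a + 1) b + α a * evenChains N β α (a + 1) b := by
  unfold evenChains oddChains
  rw [Finset.mul_sum, ← Finset.sum_add_distrib]
  refine Finset.sum_congr rfl fun k _ => ?_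
  rw [chainSum_succ_left α β _ h]

lemma one_le_evenChains {α β : ℕ → ℝ} {a b : ℕ} (N : ℕ) (hα : ∀ i < b, 0 ≤ α i)
    (hβ : ∀ i < b, 0 ≤ β i) : 1 ≤ evenChains N α β a b := by
  unfold evenChains
  rw [Finset.sum_range_succ', mul_zero, chainSum_zero]
  linarith [Finset.sum_nonneg fun k (_ : k ∈ Finset.range N) =>
    chainSum_nonneg (a := a) hα hβ (2 * (k + 1))]

lemma oddChains_nonneg {α β : ℕ → ℝ} {a b : ℕ} (N : ℕ) (hα : ∀ i < b, 0 ≤ α i)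
    (hβ : ∀ i < b, 0 ≤ β i) : 0 ≤ oddChains N α β a b :=
  Finset.sum_nonneg fun _ _ => chainSum_nonneg hα hβ _

lemma evenChains_self (N : ℕ) (α β : ℕ → ℝ) (a : ℕ) : evenChains N α β a a = 1 := by
  unfold evenChains
  rw [Finset.sum_range_succ', mul_zero, chainSum_zero, Finset.sum_eq_zero, zero_add]
  exact fun k _ => chainSum_eq_zero _ _ (by omega)

lemma oddChains_self (N : ℕ) (α β : ℕ → ℝ) (a : ℕ) : oddChains N α β a a = 0 :=
  Finset.sum_eq_zero fun k _ => chainSum_eq_zero _ _ (by omega)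

lemma evenChains_congr {α α' β β' : ℕ → ℝ} {a b : ℕ} (N : ℕ) (hα : ∀ i < b, α i = α' i)
    (hβ : ∀ i < b, β i = β' i) : evenChains N α β a b = evenChains N α' β' a b :=
  Finset.sum_congr rfl fun _ _ => chainSum_congr hα hβ _

lemma oddChains_congr {α α' β β' : ℕ → ℝ} {a b : ℕ} (N : ℕ) (hα : ∀ i < b, α i = α' i)
    (hβ : ∀ i < b, β i = β' i) : oddChains N α β a b = oddChains N α' β' a b :=
  Finset.sum_congr rfl fun _ _ => chainSum_congr hα hβ _

/-! ### The Cauchy–Schwarz inequality and its defect -/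

/-- The Cauchy–Schwarz inequality in the plane with its defect. -/
lemma add_mul_add_eq_sq {x₁ x₂ y₁ y₂ : ℝ} (hx₁ : 0 ≤ x₁) (hx₂ : 0 ≤ x₂) (hy₁ : 0 ≤ y₁)
    (hy₂ : 0 ≤ y₂) :
    (x₁ + x₂) * (y₁ + y₂) = (√(x₁ * y₁) + √(x₂ * y₂)) ^ 2 +
      (x₁ * y₂ + x₂ * y₁ - 2 * √((x₁ * y₂) * (x₂ * y₁))) := by
  have h : √(x₁ * y₁) * √(x₂ * y₂) = √((x₁ * y₂) * (x₂ * y₁)) := by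
    rw [← Real.sqrt_mul (by positivity)]; congr 1; ring
  have h1 := Real.sq_sqrt (mul_nonneg hx₁ hy₁)
  have h2 := Real.sq_sqrt (mul_nonneg hx₂ hy₂)
  rw [← h, add_sq, h1, h2]; ring

lemma two_mul_sqrt_mul_le_add {p q : ℝ} (hp : 0 ≤ p) (hq : 0 ≤ q) : 2 * √(p * q) ≤ p + q := by
  rw [Real.sqrt_mul hp]
  nlinarith [sq_nonneg (√p - √q), Real.sq_sqrt hp, Real.sq_sqrt hq]

lemma sqrt_add_sqrt_le_sqrt_add_mul_add {x₁ x₂ y₁ y₂ : ℝ} (hx₁ : 0 ≤ x₁) (hx₂ : 0 ≤ x₂)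
    (hy₁ : 0 ≤ y₁) (hy₂ : 0 ≤ y₂) :
    √(x₁ * y₁) + √(x₂ * y₂) ≤ √((x₁ + x₂) * (y₁ + y₂)) := by
  apply Real.le_sqrt_of_sq_le
  rw [add_mul_add_eq_sq hx₁ hx₂ hy₁ hy₂]
  linarith [two_mul_sqrt_mul_le_add (mul_nonneg hx₁ hy₂) (mul_nonneg hx₂ hy₁)]

lemma sqrt_add_le_add_sqrt {p q : ℝ} (hp : 0 ≤ p) (hq : 0 ≤ q) : √(p + q) ≤ √p + √q := by
  rw [Real.sqrt_le_left (by positivity)]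
  nlinarith [Real.sq_sqrt hp, Real.sq_sqrt hq, mul_nonneg (Real.sqrt_nonneg p) (Real.sqrt_nonneg q)]

/-- The ratio that makes the Cauchy–Schwarz defect `x b + a / x - 2 √(a b)` at most `2 √η`. It is
a regularization of the minimizer `√(a / b)`, which need not be a positive real. -/
noncomputable def nearMin (η a b : ℝ) : ℝ :=
  √((a + η / (1 + a + b)) / (b + η / (1 + a + b)))

lemma nearMin_pos {η a b : ℝ} (hη : 0 < η) (ha : 0 ≤ a) (hb : 0 ≤ b) : 0 < nearMin η a b := by
  unfold nearMin; positivity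

lemma nearMin_defect_le {η a b : ℝ} (hη : 0 < η) (hη1 : η ≤ 1) (ha : 0 ≤ a) (hb : 0 ≤ b) :
    nearMin η a b * b + a / nearMin η a b - 2 * √(a * b) ≤ 2 * √η := by
  set ε := η / (1 + a + b) with hε
  have hε0 : 0 < ε := by positivity
  -- this bound is the reason for the factor `1 + a + b` in `nearMin`
  have hε1 : ε * (a + b + ε) ≤ η := by
    have h1 : ε * (1 + a + b) = η := by rw [hε]; field_simp
    have h2 : ε ≤ 1 := by
      rw [hε, div_le_one (by positivity)]; linarith
    nlinarith
  have hpa : 0 < √(a + ε) := Real.sqrt_pos.2 (by positivity)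
  have hpb : 0 < √(b + ε) := Real.sqrt_pos.2 (by positivity)
  have hsa := Real.sq_sqrt (show 0 ≤ a + ε by positivity)
  have hsb := Real.sq_sqrt (show 0 ≤ b + ε by positivity)
  have hn : nearMin η a b = √(a + ε) / √(b + ε) := by
    unfold nearMin; rw [← hε, Real.sqrt_div (by positivity)]
  have h1 : nearMin η a b * b ≤ √(a + ε) * √(b + ε) := by
    rw [hn, div_mul_eq_mul_div, div_le_iff₀ hpb, mul_assoc, ← sq, hsb]
    exact mul_le_mul_of_nonneg_left (by linarith) hpa.le
  have h2 : a / nearMin η a b ≤ √(a + ε) * √(b + ε) := by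
    rw [hn, div_div_eq_mul_div, div_le_iff₀ hpa, mul_right_comm, ← sq, hsa]
    exact mul_le_mul_of_nonneg_right (by linarith) hpb.le
  have h3 : √(a + ε) * √(b + ε) ≤ √(a * b) + √η := by
    rw [← Real.sqrt_mul (by positivity)]
    calc √((a + ε) * (b + ε)) ≤ √(a * b + η) := Real.sqrt_le_sqrt (by nlinarith)
      _ ≤ √(a * b) + √η := sqrt_add_le_add_sqrt (by positivity) hη.le
  linarith

lemma sqrt_sq_add_le {P e : ℝ} (hP : 1 ≤ P) (he : 0 ≤ e) : √(P ^ 2 + 2 * e) ≤ P + e := by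
  rw [Real.sqrt_le_left (by positivity)]; nlinarith

lemma add_mul_add_le_of_defect_le {g s d D t w e : ℝ} (hg : 0 ≤ g) (hs : 0 ≤ s) (hd : 0 ≤ d)
    (hD : 0 ≤ D) (ht : 0 ≤ t) (hw : 0 < w)
    (hdef : w * (d * s) + t * g * D / w - 2 * √(t * g * D * (d * s)) ≤ 2 * e) :
    (g + w * d) * (s + t / w * D) ≤ (√(g * s) + √t * √(d * D)) ^ 2 + 2 * e := by
  have h1 := add_mul_add_eq_sq hg (mul_nonneg hw.le hd) hs (mul_nonneg (div_nonneg ht hw.le) hD)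
  have e1 : w * d * (t / w * D) = t * (d * D) := by field_simp
  have e2 : g * (t / w * D) * (w * d * s) = t * g * D * (d * s) := by field_simp
  have e3 : g * (t / w * D) = t * g * D / w := by ring
  rw [e1, e2, e3, Real.sqrt_mul ht] at h1
  rw [h1]; linarith

/-- If the common defect of two Cauchy–Schwarz inequalities is small, then a positive
combination of them is nearly an equality. -/
lemma sqrt_combination_le {g s d D t w e a b C : ℝ} (hg : 1 ≤ g) (hs : 1 ≤ s) (hd : 0 ≤ d)
    (hD : 0 ≤ D) (ht : 0 ≤ t) (hw : 0 < w) (he : 0 ≤ e) (ha : 1 ≤ a) (hb : 0 ≤ b) (hC : b ≤ C)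
    (hdef : w * (d * s) + t * g * D / w - 2 * √(t * g * D * (d * s)) ≤ 2 * e) :
    √((g + w * d) * (s + t / w * D)) * a + √((d + t / w * g) * (D + w * s)) * b ≤
      (1 + e + √(2 * e) * C) * (√(g * s) * (a + √t * b) + √(d * D) * (b + √t * a)) := by
  have hg0 := zero_le_one.trans hg
  have hs0 := zero_le_one.trans hs
  have ha0 := zero_le_one.trans ha
  have h1 := add_mul_add_le_of_defect_le hg0 hs0 hd hD ht hw hdef
  have h2 : (d + t / w * g) * (D + w * s) ≤ (√(d * D) + √t * √(g * s)) ^ 2 + 2 * e := by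
    have h := add_mul_add_eq_sq hd (mul_nonneg (div_nonneg ht hw.le) hg0) hD (mul_nonneg hw.le hs0)
    have e1 : t / w * g * (w * s) = t * (g * s) := by field_simp
    have e2 : d * (w * s) * (t / w * g * D) = t * g * D * (d * s) := by field_simp
    rw [e1, e2, Real.sqrt_mul ht] at h
    have e3 : t / w * g * D = t * g * D / w := by ring
    rw [h, e3]; linarith
  have hp : 1 ≤ √(g * s) := by rw [Real.one_le_sqrt]; nlinarith
  have hq : 0 ≤ √(d * D) := Real.sqrt_nonneg _
  have hst : 0 ≤ √t := Real.sqrt_nonneg _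
  have h2e : 0 ≤ √(2 * e) := Real.sqrt_nonneg _
  -- from here on only the values of the square roots and their bounds matter
  generalize √(g * s) = p at *
  generalize √(d * D) = q at *
  generalize √t = c at *
  have hp0 := zero_le_one.trans hp
  have hcq : 0 ≤ c * q := mul_nonneg hst hq
  have b1 : √((g + w * d) * (s + t / w * D)) ≤ p + c * q + e :=
    (Real.sqrt_le_sqrt h1).trans (sqrt_sq_add_le (by linarith) he)
  have b2 : √((d + t / w * g) * (D + w * s)) ≤ q + c * p + √(2 * e) := by
    refine (Real.sqrt_le_sqrt h2).trans
      ((sqrt_add_le_add_sqrt (by positivity) (by positivity)).trans ?_)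
    rw [Real.sqrt_sq (by positivity)]
  generalize √(2 * e) = f at *
  have hF : a ≤ p * (a + c * b) + q * (b + c * a) := by
    have : 0 ≤ p * (c * b) + q * (b + c * a) := by positivity
    nlinarith
  have hfC : f * b ≤ f * C := mul_le_mul_of_nonneg_left hC h2e
  have hF1 := mul_le_mul_of_nonneg_left hF he
  have hF2 := mul_le_mul hfC (ha.trans hF) zero_le_one (mul_nonneg h2e (hb.trans hC))
  calc _ ≤ (p + c * q + e) * a + (q + c * p + f) * b :=
        add_le_add (mul_le_mul_of_nonneg_right b1 ha0) (mul_le_mul_of_nonneg_right b2 hb)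
    _ = (p * (a + c * b) + q * (b + c * a)) + e * a + f * b * 1 := by ring
    _ ≤ (p * (a + c * b) + q * (b + c * a)) + e * (p * (a + c * b) + q * (b + c * a)) +
        f * C * (p * (a + c * b) + q * (b + c * a)) := by linarith
    _ = _ := by ring

/-! ### The recursions of the chain sums -/

section
variable {N : ℕ} {r W : ℕ → ℝ} {y : ℕ}

/-- The sum over chains `x ≤ u₁ < v₁ < … < u_{k+1} < N`, `k ≥ 0`. -/
noncomputable def deltaTildeG (N : ℕ) (r W : ℕ → ℝ) (x : ℕ) : ℝ :=
  oddChains N (uWeight r W) W x N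

/-- The sum of the `A_k(y)` over even `k`. -/
noncomputable def evenA (N : ℕ) (r : ℕ → ℝ) (y : ℕ) : ℝ :=
  ∑ k ∈ Finset.range (N + 1), calA N r (2 * k) y

/-- The sum of the `A_k(y)` over odd `k`. -/
noncomputable def oddA (N : ℕ) (r : ℕ → ℝ) (y : ℕ) : ℝ :=
  ∑ k ∈ Finset.range (N + 1), calA N r (2 * k + 1) y

/-- The inverse square root of `ψ̂`. -/
noncomputable def rootPsi (N : ℕ) (r W : ℕ → ℝ) (y : ℕ) : ℝ :=
  √(calG N r W y * tildeGStar N r W y) * evenA N r y +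
    √(deltaG N r W y * deltaTildeGStar N r W y) * oddA N r y

lemma psiHat_eq (N : ℕ) (r W : ℕ → ℝ) (y : ℕ) : psiHat N r W y = (rootPsi N r W y ^ 2)⁻¹ := rfl

lemma evenA_eq (N : ℕ) (r : ℕ → ℝ) (y : ℕ) :
    evenA N r y = evenChains N (fun i => √(tau r i)) (fun i => √(tau r i)) y N := by
  simp only [evenA, evenChains, calA_eq_chainSum]

lemma oddA_eq (N : ℕ) (r : ℕ → ℝ) (y : ℕ) :
    oddA N r y = oddChains N (fun i => √(tau r i)) (fun i => √(tau r i)) y N := by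
  simp only [oddA, oddChains, calA_eq_chainSum]

lemma one_le_evenA (N : ℕ) (r : ℕ → ℝ) (y : ℕ) : 1 ≤ evenA N r y := by
  rw [evenA_eq]
  exact one_le_evenChains N (fun _ _ => Real.sqrt_nonneg _) fun _ _ => Real.sqrt_nonneg _

lemma oddA_nonneg (N : ℕ) (r : ℕ → ℝ) (y : ℕ) : 0 ≤ oddA N r y := by
  rw [oddA_eq]
  exact oddChains_nonneg N (fun _ _ => Real.sqrt_nonneg _) fun _ _ => Real.sqrt_nonneg _

lemma evenA_eq_succ (hy : y < N) :
    evenA N r y = evenA N r (y + 1) + √(tau r y) * oddA N r (y + 1) := by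
  rw [evenA_eq, evenA_eq, oddA_eq]; exact evenChains_succ_left _ _ hy le_rfl

lemma oddA_eq_succ (hy : y < N) :
    oddA N r y = oddA N r (y + 1) + √(tau r y) * evenA N r (y + 1) := by
  rw [evenA_eq, oddA_eq, oddA_eq]; exact oddChains_succ_left _ _ _ hy

lemma evenA_self : evenA N r N = 1 := by rw [evenA_eq, evenChains_self]

lemma oddA_self : oddA N r N = 0 := by rw [oddA_eq, oddChains_self]

lemma calG_zero : calG N r W 0 = 1 := evenChains_self ..

lemma deltaG_zero : deltaG N r W 0 = 0 := oddChains_self ..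

lemma tildeGStar_zero : tildeGStar N r W 0 = 1 := evenChains_self ..

lemma deltaTildeGStar_zero : deltaTildeGStar N r W 0 = 0 := oddChains_self ..

lemma tildeG_self : tildeG N r W N = 1 := evenChains_self ..

lemma deltaTildeG_self : deltaTildeG N r W N = 0 := oddChains_self ..

lemma calG_succ (hy : y ≤ N) : calG N r W (y + 1) = calG N r W y + W y * deltaG N r W y :=
  evenChains_succ_right _ _ y.zero_le hy

lemma deltaG_succ : deltaG N r W (y + 1) = deltaG N r W y + tau r y / W y * calG N r W y :=
  oddChains_succ_right N (uWeight r W) W y.zero_le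

lemma tildeGStar_succ (hy : y ≤ N) : tildeGStar N r W (y + 1) =
    tildeGStar N r W y + tau r y / W y * deltaTildeGStar N r W y :=
  evenChains_succ_right W (uWeight r W) y.zero_le hy

lemma deltaTildeGStar_succ : deltaTildeGStar N r W (y + 1) =
    deltaTildeGStar N r W y + W y * tildeGStar N r W y :=
  oddChains_succ_right N W (uWeight r W) y.zero_le

lemma tildeG_eq_succ (hy : y < N) :
    tildeG N r W y = tildeG N r W (y + 1) + W y * deltaTildeG N r W (y + 1) :=
  evenChains_succ_left W (uWeight r W) hy le_rfl

lemma deltaTildeG_eq_succ (hy : y < N) : deltaTildeG N r W y =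
    deltaTildeG N r W (y + 1) + tau r y / W y * tildeG N r W (y + 1) :=
  oddChains_succ_left N (uWeight r W) W hy

lemma uWeight_congr {W' : ℕ → ℝ} (h : ∀ k < y, W k = W' k) (i : ℕ) (hi : i < y) :
    uWeight r W i = uWeight r W' i := by rw [uWeight, uWeight, h i hi]

lemma calG_congr {W' : ℕ → ℝ} (h : ∀ k < y, W k = W' k) : calG N r W y = calG N r W' y :=
  evenChains_congr N (uWeight_congr h) h

lemma deltaG_congr {W' : ℕ → ℝ} (h : ∀ k < y, W k = W' k) : deltaG N r W y = deltaG N r W' y :=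
  oddChains_congr N (uWeight_congr h) h

lemma tildeGStar_congr {W' : ℕ → ℝ} (h : ∀ k < y, W k = W' k) :
    tildeGStar N r W y = tildeGStar N r W' y :=
  evenChains_congr N h (uWeight_congr h)

lemma deltaTildeGStar_congr {W' : ℕ → ℝ} (h : ∀ k < y, W k = W' k) :
    deltaTildeGStar N r W y = deltaTildeGStar N r W' y :=
  oddChains_congr N h (uWeight_congr h)

lemma tildeG_congr {W' : ℕ → ℝ} (h : ∀ k < N, W k = W' k) : tildeG N r W y = tildeG N r W' y :=
  evenChains_congr N h (uWeight_congr h)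

lemma rootPsi_congr {W' : ℕ → ℝ} (h : ∀ k < y, W k = W' k) :
    rootPsi N r W y = rootPsi N r W' y := by
  unfold rootPsi
  rw [calG_congr h, tildeGStar_congr h, deltaG_congr h, deltaTildeGStar_congr h]

lemma tau_nonneg (hr : ∀ x ≤ N, 0 ≤ r x ∧ r x ≤ 1) (hy : y < N) : 0 ≤ tau r y := by
  have h1 := hr y hy.le
  have h2 := hr (y + 1) hy
  unfold tau
  nlinarith

lemma uWeight_nonneg (hr : ∀ x ≤ N, 0 ≤ r x ∧ r x ≤ 1) (hW : ∀ k, 0 < W k) (hy : y ≤ N) (i : ℕ)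
    (hi : i < y) : 0 ≤ uWeight r W i :=
  div_nonneg (tau_nonneg hr (hi.trans_le hy)) (hW i).le

variable (hr : ∀ x ≤ N, 0 ≤ r x ∧ r x ≤ 1) (hW : ∀ k, 0 < W k)
include hr hW

lemma one_le_calG (hy : y ≤ N) : 1 ≤ calG N r W y :=
  one_le_evenChains N (uWeight_nonneg hr hW hy) fun i _ => (hW i).le

lemma deltaG_nonneg (hy : y ≤ N) : 0 ≤ deltaG N r W y :=
  oddChains_nonneg N (uWeight_nonneg hr hW hy) fun i _ => (hW i).le

lemma one_le_tildeGStar (hy : y ≤ N) : 1 ≤ tildeGStar N r W y :=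
  one_le_evenChains N (fun i _ => (hW i).le) (uWeight_nonneg hr hW hy)

lemma deltaTildeGStar_nonneg (hy : y ≤ N) : 0 ≤ deltaTildeGStar N r W y :=
  oddChains_nonneg N (fun i _ => (hW i).le) (uWeight_nonneg hr hW hy)

lemma one_le_tildeG : 1 ≤ tildeG N r W y :=
  one_le_evenChains N (fun i _ => (hW i).le) (uWeight_nonneg hr hW le_rfl)

lemma deltaTildeG_nonneg : 0 ≤ deltaTildeG N r W y :=
  oddChains_nonneg N (uWeight_nonneg hr hW le_rfl) fun i _ => (hW i).le

lemma calG_mono {x : ℕ} (hxy : x ≤ y) (hy : y ≤ N) : calG N r W x ≤ calG N r W y := by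
  induction y, hxy using Nat.le_induction with
  | base => rfl
  | succ m hm ih =>
    rw [calG_succ (by omega)]
    nlinarith [ih (by omega), hW m, deltaG_nonneg hr hW (y := m) (by omega)]

lemma tildeG_le_zero (hy : y ≤ N) : tildeG N r W y ≤ tildeG N r W 0 := by
  induction y with
  | zero => rfl
  | succ m ih =>
    have := tildeG_eq_succ (r := r) (W := W) (show m < N by omega)
    nlinarith [ih (by omega), hW m, deltaTildeG_nonneg hr hW (y := m + 1)]

lemma calG_mul_tildeGStar_le_rootPsi_sq (hy : y ≤ N) :
    calG N r W y * tildeGStar N r W y ≤ rootPsi N r W y ^ 2 := by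
  have h1 := one_le_calG hr hW hy
  have h2 := one_le_tildeGStar hr hW hy
  have h0 : 0 ≤ calG N r W y * tildeGStar N r W y := by positivity
  have h3 : √(calG N r W y * tildeGStar N r W y) ≤ rootPsi N r W y := by
    unfold rootPsi
    have h4 := one_le_evenA N r y
    have h5 := oddA_nonneg N r y
    have := mul_nonneg (Real.sqrt_nonneg (deltaG N r W y * deltaTildeGStar N r W y)) h5
    nlinarith [Real.sqrt_nonneg (calG N r W y * tildeGStar N r W y)]
  calc calG N r W y * tildeGStar N r W y = √(calG N r W y * tildeGStar N r W y) ^ 2 :=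
        (Real.sq_sqrt h0).symm
    _ ≤ _ := pow_le_pow_left₀ (Real.sqrt_nonneg _) h3 2

lemma one_le_rootPsi (hy : y ≤ N) : 1 ≤ rootPsi N r W y := by
  have h1 := one_le_calG hr hW hy
  have h2 := one_le_tildeGStar hr hW hy
  have h3 := calG_mul_tildeGStar_le_rootPsi_sq hr hW hy
  have h4 : 0 ≤ rootPsi N r W y := by
    have := one_le_evenA N r y
    have := oddA_nonneg N r y
    unfold rootPsi; positivity
  nlinarith

/-- Two instances of the Cauchy–Schwarz inequality, one for the even and one for the odd part. -/
lemma rootPsi_le_succ (hy : y < N) : rootPsi N r W y ≤ rootPsi N r W (y + 1) := by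
  have hg := (zero_le_one.trans (one_le_calG hr hW hy.le))
  have hs := (zero_le_one.trans (one_le_tildeGStar hr hW hy.le))
  have hd := deltaG_nonneg hr hW hy.le
  have hds := deltaTildeGStar_nonneg hr hW hy.le
  have ht := tau_nonneg hr hy
  have hw := hW y
  have he := zero_le_one.trans (one_le_evenA N r (y + 1))
  have ho := oddA_nonneg N r (y + 1)
  have h1 := sqrt_add_sqrt_le_sqrt_add_mul_add hg (mul_nonneg hw.le hd) hs
    (mul_nonneg (div_nonneg ht hw.le) hds)
  have h2 := sqrt_add_sqrt_le_sqrt_add_mul_add hd (mul_nonneg (div_nonneg ht hw.le) hg) hds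
    (mul_nonneg hw.le hs)
  have e1 : W y * deltaG N r W y * (tau r y / W y * deltaTildeGStar N r W y) =
      tau r y * (deltaG N r W y * deltaTildeGStar N r W y) := by field_simp
  have e2 : tau r y / W y * calG N r W y * (W y * tildeGStar N r W y) =
      tau r y * (calG N r W y * tildeGStar N r W y) := by field_simp
  rw [e1, Real.sqrt_mul ht] at h1
  rw [e2, Real.sqrt_mul ht] at h2
  unfold rootPsi
  rw [calG_succ hy.le, tildeGStar_succ hy.le, deltaG_succ, deltaTildeGStar_succ, evenA_eq_succ hy,
    oddA_eq_succ hy]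
  linarith [mul_le_mul_of_nonneg_right h1 he, mul_le_mul_of_nonneg_right h2 ho]

/-- At a suitable scale increment, `rootPsi` nearly stays constant. -/
lemma rootPsi_succ_le {η C : ℝ} (hη : 0 < η) (hη1 : η ≤ 1) (hC : oddA N r (y + 1) ≤ C)
    (hy : y < N)
    (hmin : W y = nearMin η (tau r y * calG N r W y * deltaTildeGStar N r W y)
      (deltaG N r W y * tildeGStar N r W y)) :
    rootPsi N r W (y + 1) ≤ (1 + √η + √(2 * √η) * C) * rootPsi N r W y := by
  have hg := one_le_calG hr hW hy.le
  have hs := one_le_tildeGStar hr hW hy.le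
  have hd := deltaG_nonneg hr hW hy.le
  have hds := deltaTildeGStar_nonneg hr hW hy.le
  have ht := tau_nonneg hr hy
  have hdef := nearMin_defect_le hη hη1 (a := tau r y * calG N r W y * deltaTildeGStar N r W y)
    (b := deltaG N r W y * tildeGStar N r W y) (by positivity) (by positivity)
  rw [← hmin] at hdef
  have h := sqrt_combination_le hg hs hd hds ht (hW y) (Real.sqrt_nonneg η)
    (one_le_evenA N r (y + 1)) (oddA_nonneg N r (y + 1)) hC hdef
  unfold rootPsi
  rw [calG_succ hy.le, tildeGStar_succ hy.le, deltaG_succ, deltaTildeGStar_succ, evenA_eq_succ hy,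
    oddA_eq_succ hy]
  exact h

omit hr hW in
/-- At the bottom level nothing is chosen and `rootPsi` stays constant. -/
lemma rootPsi_one (hN : 0 < N) (h0 : W 0 = 1) : rootPsi N r W 1 = rootPsi N r W 0 := by
  unfold rootPsi
  rw [← zero_add 1, calG_succ N.zero_le, tildeGStar_succ N.zero_le, deltaG_succ,
    deltaTildeGStar_succ, evenA_eq_succ hN, calG_zero, deltaG_zero, tildeGStar_zero,
    deltaTildeGStar_zero, h0]
  simp

end

/-! ### The harmonic functions before and after the turning time -/

/-- The value of the way up, as a function of the position; `ψ̂` of the running maximum is the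
remaining factor. -/
noncomputable def preVal (N : ℕ) (r W : ℕ → ℝ) (x : ℕ) : ℝ :=
  (∏ i ∈ Finset.Ico x N, r i) * (∏ i ∈ Finset.Icc 1 N, r i) * calG N r W x

/-- The value of the way down, as a function of the position. -/
noncomputable def postVal (N : ℕ) (r W : ℕ → ℝ) (x : ℕ) : ℝ :=
  (∏ i ∈ Finset.Icc 1 x, r i) * (tildeG N r W x / tildeG N r W 0)

section HarmonicFunctions

variable {N : ℕ} {r W : ℕ → ℝ}

lemma preVal_zero (hN : 0 < N) : preVal N r W 0 = r 0 * preVal N r W 1 := by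
  have h : calG N r W 1 = calG N r W 0 := by
    rw [← zero_add 1, calG_succ N.zero_le, deltaG_zero]; ring
  unfold preVal
  rw [h, Finset.prod_eq_prod_Ico_succ_bot hN]; ring

lemma preVal_harmonic {x : ℕ} {w : ℝ} (hw : 0 < w) (hx : x + 1 < N) (hW0 : W x ≠ 0)
    (hW : W (x + 1) = W x * w) :
    r (x + 1) * (1 / (1 + w) * preVal N r W (x + 2) + (1 - 1 / (1 + w)) * preVal N r W x) =
      preVal N r W (x + 1) := by
  have h1 : calG N r W (x + 2) = calG N r W (x + 1) + W x * w * deltaG N r W (x + 1) := by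
    rw [show x + 2 = x + 1 + 1 from rfl, calG_succ hx.le, hW]
  have h2 : calG N r W (x + 1) = calG N r W x + W x * deltaG N r W x := calG_succ (by omega)
  have h3 : deltaG N r W (x + 1) = deltaG N r W x + (1 - r x * r (x + 1)) / W x * calG N r W x :=
    deltaG_succ
  unfold preVal
  rw [Finset.prod_eq_prod_Ico_succ_bot (show x < N by omega), Finset.prod_eq_prod_Ico_succ_bot hx,
    h1, h2, h3, show x + 1 + 1 = x + 2 from rfl]
  have : 1 + w ≠ 0 := by positivity
  field_simp
  ring

lemma postVal_zero (h : tildeG N r W 0 ≠ 0) : postVal N r W 0 = 1 := by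
  simp [postVal, h]

lemma postVal_harmonic {x : ℕ} {w : ℝ} (hw : 0 < w) (hx : x + 1 < N) (hW0 : W x ≠ 0)
    (hW : W (x + 1) = W x * w) :
    r (x + 1) * (1 / (1 + w) * postVal N r W (x + 2) + (1 - 1 / (1 + w)) * postVal N r W x) =
      postVal N r W (x + 1) := by
  have h1 : tildeG N r W x = tildeG N r W (x + 1) + W x * deltaTildeG N r W (x + 1) :=
    tildeG_eq_succ (by omega)
  have h2 : tildeG N r W (x + 1) = tildeG N r W (x + 2) + W (x + 1) * deltaTildeG N r W (x + 2) :=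
    tildeG_eq_succ hx
  have h3 : deltaTildeG N r W (x + 1) = deltaTildeG N r W (x + 2) +
      (1 - r (x + 1) * r (x + 2)) / W (x + 1) * tildeG N r W (x + 2) := deltaTildeG_eq_succ hx
  unfold postVal
  rw [Finset.prod_Icc_succ_top (show 1 ≤ x + 1 + 1 by omega), Finset.prod_Icc_succ_top (by omega),
    h1, h3, h2, hW, show x + 1 + 1 = x + 2 from rfl]
  have : 1 + w ≠ 0 := by positivity
  field_simp
  ring

lemma postVal_top (hN : 0 < N) : postVal N r W N = r N * postVal N r W (N - 1) := by
  obtain ⟨n, rfl⟩ : ∃ n, N = n + 1 := ⟨N - 1, by omega⟩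
  have h : tildeG (n + 1) r W n = tildeG (n + 1) r W (n + 1) := by
    rw [tildeG_eq_succ (Nat.lt_succ_self n), deltaTildeG_self]; ring
  unfold postVal
  rw [Nat.add_sub_cancel, h, Finset.prod_Icc_succ_top (by omega)]; ring

lemma preVal_congr {W' : ℕ → ℝ} {x : ℕ} (h : ∀ k < x, W k = W' k) :
    preVal N r W x = preVal N r W' x := by
  unfold preVal; rw [calG_congr h]

lemma postVal_congr {W' : ℕ → ℝ} {x : ℕ} (h : ∀ k < N, W k = W' k) :
    postVal N r W x = postVal N r W' x := by
  unfold postVal; rw [tildeG_congr h, tildeG_congr h]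

lemma psiHat_congr {W' : ℕ → ℝ} {y : ℕ} (h : ∀ k < y, W k = W' k) :
    psiHat N r W y = psiHat N r W' y := by
  rw [psiHat_eq, psiHat_eq, rootPsi_congr h]

variable (hr : ∀ x ≤ N, 0 ≤ r x ∧ r x ≤ 1) (hW : ∀ k, 0 < W k)
include hr

lemma prod_r_mem {s : Finset ℕ} (hs : ∀ i ∈ s, i ≤ N) : 0 ≤ ∏ i ∈ s, r i ∧ ∏ i ∈ s, r i ≤ 1 :=
  ⟨Finset.prod_nonneg fun i hi => (hr i (hs i hi)).1,
    Finset.prod_le_one (fun i hi => (hr i (hs i hi)).1) fun i hi => (hr i (hs i hi)).2⟩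

include hW

/-- At the turning time the two value functions fit together. -/
lemma preVal_mul_psiHat_top : preVal N r W N * psiHat N r W N = postVal N r W N := by
  have h1 := one_le_calG hr hW le_rfl
  have h2 := one_le_tildeGStar hr hW le_rfl
  have h3 : tildeGStar N r W N = tildeG N r W 0 := rfl
  have h4 : rootPsi N r W N ^ 2 = calG N r W N * tildeGStar N r W N := by
    rw [rootPsi, evenA_self, oddA_self, mul_zero, add_zero, mul_one, Real.sq_sqrt (by positivity)]
  rw [h3] at h2 h4
  unfold preVal postVal
  rw [psiHat_eq, h4, tildeG_self]
  simp only [Finset.Ico_self, Finset.prod_empty, one_mul]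
  field_simp

lemma preVal_nonneg {x : ℕ} (hx : x ≤ N) : 0 ≤ preVal N r W x := by
  have h1 := (prod_r_mem hr (s := Finset.Ico x N) (fun i hi => (Finset.mem_Ico.1 hi).2.le)).1
  have h2 := (prod_r_mem hr (s := Finset.Icc 1 N) (fun i hi => (Finset.mem_Icc.1 hi).2)).1
  have h3 := one_le_calG hr hW hx
  unfold preVal; positivity

omit hr hW in
lemma psiHat_nonneg (y : ℕ) : 0 ≤ psiHat N r W y := by rw [psiHat_eq]; positivity

lemma preVal_mul_psiHat_le_one {x y : ℕ} (hxy : x ≤ y) (hy : y ≤ N) :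
    preVal N r W x * psiHat N r W y ≤ 1 := by
  have h1 := prod_r_mem hr (s := Finset.Ico x N) (fun i hi => (Finset.mem_Ico.1 hi).2.le)
  have h2 := prod_r_mem hr (s := Finset.Icc 1 N) (fun i hi => (Finset.mem_Icc.1 hi).2)
  have h3 := one_le_calG hr hW (hxy.trans hy)
  have h4 := calG_mono hr hW hxy hy
  have h5 := calG_mul_tildeGStar_le_rootPsi_sq hr hW hy
  have h6 := one_le_tildeGStar hr hW hy
  have h7 : 1 ≤ rootPsi N r W y ^ 2 := one_le_pow₀ (one_le_rootPsi hr hW hy)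
  rw [psiHat_eq, ← div_eq_mul_inv, div_le_one (by positivity)]
  unfold preVal
  have h8 : (∏ i ∈ Finset.Ico x N, r i) * (∏ i ∈ Finset.Icc 1 N, r i) ≤ 1 :=
    mul_le_one₀ h1.2 h2.1 h2.2
  nlinarith

lemma postVal_mem {x : ℕ} (hx : x ≤ N) : 0 ≤ postVal N r W x ∧ postVal N r W x ≤ 1 := by
  have h1 := prod_r_mem hr (s := Finset.Icc 1 x) (fun i hi => (Finset.mem_Icc.1 hi).2.trans hx)
  have h2 := one_le_tildeG hr hW (y := x)
  have h3 := one_le_tildeG hr hW (y := 0)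
  have h4 := tildeG_le_zero hr hW hx
  unfold postVal
  refine ⟨mul_nonneg h1.1 (by positivity), mul_le_one₀ h1.2 (by positivity) ?_⟩
  rw [div_le_one (by linarith)]; exact h4

lemma psiHat_succ_le {y : ℕ} (hy : y < N) : psiHat N r W (y + 1) ≤ psiHat N r W y := by
  have h1 := one_le_rootPsi hr hW hy.le
  have h2 := rootPsi_le_succ hr hW hy
  rw [psiHat_eq, psiHat_eq]
  exact inv_anti₀ (by positivity) (pow_le_pow_left₀ (by positivity) h2 2)

end HarmonicFunctions

/-! ### Paths -/

section Paths

variable {N : ℕ} {E : Type*} {n : ℕ} {ω ω' : Path N E}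

/-- Up to time `n`, the path starts at `0` and moves between nearest neighbours. -/
def IsWalk (n : ℕ) (ω : Path N E) : Prop :=
  pos 0 ω = 0 ∧ ∀ m < n, pos (m + 1) ω = pos m ω + 1 ∨ pos (m + 1) ω + 1 = pos m ω

lemma IsWalk.mono {m : ℕ} (h : IsWalk n ω) (hmn : m ≤ n) : IsWalk m ω :=
  ⟨h.1, fun k hk => h.2 k (hk.trans_le hmn)⟩

lemma pos_le (n : ℕ) (ω : Path N E) : pos n ω ≤ N := Nat.lt_succ_iff.1 (ω n).2.2

lemma runMax_zero (ω : Path N E) : runMax 0 ω = pos 0 ω := by simp [runMax]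

lemma runMax_succ (n : ℕ) (ω : Path N E) :
    runMax (n + 1) ω = max (runMax n ω) (pos (n + 1) ω) := by
  unfold runMax
  rw [Finset.range_add_one, Finset.sup_insert, max_comm]

lemma pos_le_runMax {m : ℕ} (h : m ≤ n) (ω : Path N E) : pos m ω ≤ runMax n ω :=
  Finset.le_sup (f := fun m => pos m ω) (Finset.mem_range.2 (Nat.lt_succ_of_le h))

lemma runMax_le (n : ℕ) (ω : Path N E) : runMax n ω ≤ N := Finset.sup_le fun m _ => pos_le m ω

lemma exists_pos_eq_runMax (n : ℕ) (ω : Path N E) : ∃ m ≤ n, pos m ω = runMax n ω := by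
  induction n with
  | zero => exact ⟨0, le_rfl, (runMax_zero ω).symm⟩
  | succ n ih =>
    obtain ⟨m, hm, h⟩ := ih
    rw [runMax_succ]
    rcases le_total (runMax n ω) (pos (n + 1) ω) with h' | h'
    · exact ⟨n + 1, le_rfl, (max_eq_right h').symm⟩
    · exact ⟨m, by omega, by rw [h, max_eq_left h']⟩

lemma IsWalk.exists_pos_eq (h : IsWalk n ω) {k : ℕ} (hk : k ≤ runMax n ω) :
    ∃ m ≤ n, pos m ω = k := by
  induction n with
  | zero =>
    rw [runMax_zero, h.1] at hk
    exact ⟨0, le_rfl, by rw [h.1]; omega⟩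
  | succ n ih =>
    by_cases hk' : k ≤ runMax n ω
    · obtain ⟨m, hm, hmk⟩ := ih (h.mono n.le_succ) hk'
      exact ⟨m, by omega, hmk⟩
    · have h1 := pos_le_runMax le_rfl ω (n := n)
      rw [runMax_succ] at hk
      have h2 := h.2 n n.lt_succ_self
      exact ⟨n + 1, le_rfl, by omega⟩

/-- The shuttle time has occurred by time `n`. -/
def Shuttled (n : ℕ) (ω : Path N E) : Prop := ∃ j ≤ n, pos j ω = 0 ∧ ∃ m < j, pos m ω = N

lemma shuttleTime_le_iff : shuttleTime ω ≤ n ↔ Shuttled n ω := by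
  unfold shuttleTime
  constructor
  · intro h
    rcases Set.eq_empty_or_nonempty
      {k : ℕ∞ | ∃ n : ℕ, k = n ∧ pos n ω = 0 ∧ ∃ m < n, pos m ω = N} with he | he
    · rw [he, sInf_empty] at h
      exact absurd h (not_le.2 (ENat.natCast_lt_top n))
    · obtain ⟨j, hj, h0, hm⟩ := csInf_mem he
      rw [hj] at h
      exact ⟨j, by exact_mod_cast h, h0, hm⟩
  · rintro ⟨j, hj, h0, hm⟩
    have h1 : (j : ℕ∞) ≤ n := by exact_mod_cast hj
    exact le_trans (sInf_le ⟨j, rfl, h0, hm⟩) h1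

lemma lt_shuttleTime_iff : (n : ℕ∞) < shuttleTime ω ↔ ¬ Shuttled n ω := by
  rw [← shuttleTime_le_iff, not_le]

lemma Shuttled.mono {m : ℕ} (h : Shuttled m ω) (hmn : m ≤ n) : Shuttled n ω := by
  obtain ⟨j, hj, h'⟩ := h
  exact ⟨j, hj.trans hmn, h'⟩

lemma Shuttled.runMax_eq (h : Shuttled n ω) : runMax n ω = N := by
  obtain ⟨j, hj, -, m, hm, h'⟩ := h
  exact le_antisymm (runMax_le n ω) (h'.symm.le.trans (pos_le_runMax (by omega) ω))

lemma not_shuttled_succ (h : runMax n ω < N) : ¬ Shuttled (n + 1) ω := by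
  rintro ⟨j, hj, -, m, hm, h'⟩
  exact absurd (pos_le_runMax (show m ≤ n by omega) ω) (by omega)

lemma not_shuttled (h : runMax n ω < N) : ¬ Shuttled n ω := fun h' => h.ne h'.runMax_eq

lemma stopTime_of_not_shuttled (h : ¬ Shuttled n ω) : stopTime n ω = n := by
  rw [← lt_shuttleTime_iff] at h
  rw [stopTime, min_eq_left h.le, ENat.toNat_natCast]

lemma pos_stopTime (h : Shuttled n ω) : pos (stopTime n ω) ω = 0 := by
  have h1 := shuttleTime_le_iff.2 h
  obtain ⟨j, hj, h0, hm⟩ := h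
  have hne : {k : ℕ∞ | ∃ n : ℕ, k = n ∧ pos n ω = 0 ∧ ∃ m < n, pos m ω = N}.Nonempty :=
    ⟨j, j, rfl, h0, hm⟩
  obtain ⟨i, hi, hi0, -⟩ := csInf_mem hne
  have h2 : shuttleTime ω = i := hi
  rw [stopTime, min_eq_right h1, h2, ENat.toNat_natCast]
  exact hi0

lemma pos_ne_zero (hN : 1 ≤ N) (h : ¬ Shuttled n ω) (hM : runMax n ω = N) : pos n ω ≠ 0 := by
  intro h0
  obtain ⟨m, hm, hmN⟩ := exists_pos_eq_runMax n ω
  have : m ≠ n := by rintro rfl; omega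
  exact h ⟨n, le_rfl, h0, m, by omega, hmN.trans hM⟩

lemma discount_eq_prod_range (r : ℕ → ℝ) (n : ℕ) (ω : Path N E) :
    discount r n ω = ∏ u ∈ Finset.range (stopTime n ω), r (pos u ω) := by
  unfold discount stopTime
  refine Finset.prod_congr ?_ fun _ _ => rfl
  ext u
  have hfin : min (n : ℕ∞) (shuttleTime ω) ≠ ⊤ := by simp
  rw [Finset.mem_filter, Finset.mem_range, Finset.mem_range, ← Nat.cast_lt (α := ℕ∞) (m := u),
    ← Nat.cast_lt (α := ℕ∞) (m := u) (n := ENat.toNat _), ENat.natCast_toNat hfin, lt_min_iff]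

open Classical in
lemma discount_succ (r : ℕ → ℝ) (n : ℕ) (ω : Path N E) :
    discount r (n + 1) ω = discount r n ω * if Shuttled n ω then 1 else r (pos n ω) := by
  unfold discount
  simp only [lt_shuttleTime_iff]
  rw [Finset.range_add_one, Finset.filter_insert]
  by_cases h : Shuttled n ω
  · simp [h]
  · rw [if_pos h, if_neg h, Finset.prod_insert (by simp), mul_comm]

lemma discount_mem {r : ℕ → ℝ} (hr : ∀ x ≤ N, 0 ≤ r x ∧ r x ≤ 1) (n : ℕ) (ω : Path N E) :
    0 ≤ discount r n ω ∧ discount r n ω ≤ 1 :=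
  ⟨Finset.prod_nonneg fun _ _ => (hr _ (pos_le _ _)).1,
    Finset.prod_le_one (fun _ _ => (hr _ (pos_le _ _)).1) fun _ _ => (hr _ (pos_le _ _)).2⟩

lemma discount_antitone {r : ℕ → ℝ} (hr : ∀ x ≤ N, 0 ≤ r x ∧ r x ≤ 1) (ω : Path N E) :
    Antitone fun n => discount r n ω := by
  refine antitone_nat_of_succ_le fun n => ?_
  classical
  rw [discount_succ]
  refine mul_le_of_le_one_right (discount_mem hr n ω).1 ?_
  split_ifs
  exacts [le_rfl, (hr _ (pos_le _ _)).2]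

lemma discount_eq_of_shuttled (r : ℕ → ℝ) (h : Shuttled n ω) {m : ℕ} (hm : n ≤ m) :
    discount r m ω = discount r n ω := by
  classical
  induction m, hm using Nat.le_induction with
  | base => rfl
  | succ m hm ih => rw [discount_succ, if_pos (h.mono hm), mul_one, ih]

lemma payoff_eq {r : ℕ → ℝ} (hr : ∀ x ≤ N, 0 ≤ r x ∧ r x ≤ 1) (h : Shuttled n ω) :
    payoff r ω = discount r n ω := by
  refine le_antisymm (ciInf_le ⟨0, ?_⟩ n) (le_ciInf fun m => ?_)
  · rintro _ ⟨m, rfl⟩; exact (discount_mem hr m ω).1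
  · rcases le_total n m with hm | hm
    · exact (discount_eq_of_shuttled r h hm).ge
    · exact discount_antitone hr ω hm

lemma payoff_mem {r : ℕ → ℝ} (hr : ∀ x ≤ N, 0 ≤ r x ∧ r x ≤ 1) (ω : Path N E) :
    0 ≤ payoff r ω ∧ payoff r ω ≤ 1 :=
  ⟨le_ciInf fun _ => (discount_mem hr _ ω).1,
    (ciInf_le ⟨0, by rintro _ ⟨_, rfl⟩; exact (discount_mem hr _ ω).1⟩ 0).trans
      (discount_mem hr 0 ω).2⟩

/-! ### Dependence on the history only -/

lemma pos_congr (h : ∀ i ≤ n, ω i = ω' i) {m : ℕ} (hm : m ≤ n) : pos m ω = pos m ω' := by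
  rw [pos, pos, h m hm]

lemma runMax_congr (h : ∀ i ≤ n, ω i = ω' i) : runMax n ω = runMax n ω' :=
  Finset.sup_congr rfl fun _ hm => pos_congr h (Nat.lt_succ_iff.1 (Finset.mem_range.1 hm))

lemma shuttled_congr (h : ∀ i ≤ n, ω i = ω' i) {m : ℕ} (hm : m ≤ n) :
    Shuttled m ω ↔ Shuttled m ω' := by
  unfold Shuttled
  refine exists_congr fun j => and_congr_right fun hj => ?_
  rw [pos_congr h (hj.trans hm)]
  refine and_congr_right fun _ => exists_congr fun k => and_congr_right fun hk => ?_
  rw [pos_congr h (by omega)]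

lemma discount_congr (r : ℕ → ℝ) (h : ∀ i ≤ n, ω i = ω' i) : discount r n ω = discount r n ω' := by
  classical
  unfold discount
  simp only [lt_shuttleTime_iff]
  refine Finset.prod_congr (Finset.filter_congr fun u hu => ?_) fun u hu => ?_
  · rw [shuttled_congr h (Finset.mem_range.1 hu).le]
  · rw [pos_congr h (Finset.mem_range.1 (Finset.mem_filter.1 hu).1).le]

lemma IsWalk.congr (h : ∀ i ≤ n, ω i = ω' i) (hω : IsWalk n ω) : IsWalk n ω' := by
  refine ⟨by rw [← pos_congr h n.zero_le]; exact hω.1, fun m hm => ?_⟩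
  rw [← pos_congr h hm, ← pos_congr h hm.le]
  exact hω.2 m hm

/-- The path frozen after time `n`. -/
def freeze (n : ℕ) (ω : Path N E) : Path N E := fun i => ω (min i n)

lemma freeze_apply {i : ℕ} (hi : i ≤ n) (ω : Path N E) : freeze n ω i = ω i := by
  rw [freeze, min_eq_left hi]

variable [MeasurableSpace E]

/-- By adaptedness, a ratio is determined by the history once its level has been visited. -/
lemma Control.w_congr (s : Control N E) (h : ∀ i ≤ n, ω i = ω' i) {x : ℕ}
    (hx : ∃ m ≤ n, pos m ω = x) : s.w x ω = s.w x ω' := by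
  classical
  have hex : ∃ m, pos m ω = x := let ⟨m, _, hm⟩ := hx; ⟨m, hm⟩
  set k := Nat.find hex
  have hk : k ≤ n := let ⟨m, hmn, hm⟩ := hx; (Nat.find_min' hex hm).trans hmn
  have h1 : ω ∈ firstVisit x k := ⟨Nat.find_spec hex, fun m hm => Nat.find_min hex hm⟩
  have h2 : ω' ∈ firstVisit x k :=
    ⟨by rw [← pos_congr h hk]; exact h1.1, fun m hm => by
      rw [← pos_congr h (hm.le.trans hk)]; exact h1.2 m hm⟩
  have h3 := (s.adapted_w x k).dependsOn_of_piLE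
  have h4 := h3 (x := ω) (y := ω') fun i hi => h i (le_trans hi hk)
  rwa [Set.indicator_of_mem h1, Set.indicator_of_mem h2] at h4

lemma Control.W_congr (s : Control N E) (h : ∀ i ≤ n, ω i = ω' i) (hω : IsWalk n ω) {k : ℕ}
    (hk : k ≤ runMax n ω) : s.W ω k = s.W ω' k :=
  Finset.prod_congr rfl fun _ hj =>
    s.w_congr h (hω.exists_pos_eq ((Finset.mem_Icc.1 hj).2.trans hk))

lemma Control.W_pos (s : Control N E) (ω : Path N E) (k : ℕ) : 0 < s.W ω k :=
  Finset.prod_pos fun j _ => s.pos_w j ω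

lemma Control.W_zero (s : Control N E) (ω : Path N E) : s.W ω 0 = 1 := by simp [Control.W]

lemma Control.W_succ (s : Control N E) (ω : Path N E) (k : ℕ) :
    s.W ω (k + 1) = s.W ω k * s.w (k + 1) ω := by
  unfold Control.W
  rw [Finset.prod_Icc_succ_top (by omega)]

end Paths

section Values

variable {N : ℕ} {E : Type*} [MeasurableSpace E] {n : ℕ} {ω ω' : Path N E} {r : ℕ → ℝ}

/-! ### The candidate along a path -/

lemma solution_of_lt (s : Control N E) (h : runMax n ω < N) :
    solution r s n ω =
      discount r n ω * (preVal N r (s.W ω) (pos n ω) * psiHat N r (s.W ω) (runMax n ω)) := by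
  rw [discount_eq_prod_range, stopTime_of_not_shuttled (not_shuttled h), solution, if_pos h, preVal]
  ring

lemma solution_of_not_shuttled (s : Control N E) (h : runMax n ω = N) (h' : ¬ Shuttled n ω) :
    solution r s n ω = discount r n ω * postVal N r (s.W ω) (pos n ω) := by
  rw [discount_eq_prod_range, solution, if_neg h.not_lt, stopTime_of_not_shuttled h', postVal]
  ring

lemma solution_of_shuttled (hr : ∀ x ≤ N, 0 ≤ r x ∧ r x ≤ 1) (s : Control N E)
    (h : Shuttled n ω) : solution r s n ω = discount r n ω := by
  have h0 := one_le_tildeG hr (s.W_pos ω) (y := 0)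
  rw [discount_eq_prod_range, solution, if_neg h.runMax_eq.not_lt, pos_stopTime h]
  have : tildeG N r (s.W ω) 0 ≠ 0 := by positivity
  simp [this]

lemma solution_mem (hr : ∀ x ≤ N, 0 ≤ r x ∧ r x ≤ 1) (s : Control N E) (n : ℕ) (ω : Path N E) :
    0 ≤ solution r s n ω ∧ solution r s n ω ≤ 1 := by
  have hd := discount_mem hr n ω
  by_cases h : Shuttled n ω
  · rwa [solution_of_shuttled hr s h]
  rcases (runMax_le n ω).lt_or_eq with hM | hM
  · rw [solution_of_lt s hM]
    have hx := pos_le_runMax le_rfl ω (n := n)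
    have h1 := mul_nonneg (preVal_nonneg hr (s.W_pos ω) (pos_le n ω))
      (psiHat_nonneg (N := N) (r := r) (W := s.W ω) (runMax n ω))
    have h2 := preVal_mul_psiHat_le_one hr (s.W_pos ω) hx hM.le
    exact ⟨mul_nonneg hd.1 h1, mul_le_one₀ hd.2 h1 h2⟩
  · rw [solution_of_not_shuttled s hM h]
    have h1 := postVal_mem hr (s.W_pos ω) (pos_le n ω)
    exact ⟨mul_nonneg hd.1 h1.1, mul_le_one₀ hd.2 h1.1 h1.2⟩

/-- The candidate only involves the scale increments below the running maximum. -/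
lemma solution_congr_control (hr : ∀ x ≤ N, 0 ≤ r x ∧ r x ≤ 1) {s s' : Control N E}
    (h : ∀ k < runMax n ω, s.W ω k = s'.W ω k) : solution r s n ω = solution r s' n ω := by
  by_cases hS : Shuttled n ω
  · rw [solution_of_shuttled hr s hS, solution_of_shuttled hr s' hS]
  rcases (runMax_le n ω).lt_or_eq with hM | hM
  · rw [solution_of_lt s hM, solution_of_lt s' hM, psiHat_congr h,
      preVal_congr fun k hk => h k (hk.trans_le (pos_le_runMax le_rfl ω))]
  · rw [solution_of_not_shuttled s hM hS, solution_of_not_shuttled s' hM hS, postVal_congr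
      fun k hk => h k (by omega)]

lemma solution_congr (hr : ∀ x ≤ N, 0 ≤ r x ∧ r x ≤ 1) (s : Control N E)
    (h : ∀ i ≤ n, ω i = ω' i) (hω : IsWalk n ω) : solution r s n ω = solution r s n ω' := by
  have hM' := runMax_congr h
  have hW : ∀ k < runMax n ω, s.W ω k = s.W ω' k := fun k hk => s.W_congr h hω hk.le
  have hx := pos_le_runMax le_rfl ω (n := n)
  by_cases hS : Shuttled n ω
  · rw [solution_of_shuttled hr s hS, solution_of_shuttled hr s ((shuttled_congr h le_rfl).1 hS),
      discount_congr r h]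
  rcases (runMax_le n ω).lt_or_eq with hM | hM
  · rw [solution_of_lt s hM, solution_of_lt s (hM' ▸ hM), psiHat_congr hW,
      preVal_congr fun k hk => hW k (hk.trans_le hx), discount_congr r h, pos_congr h le_rfl, hM']
  · rw [solution_of_not_shuttled s hM hS, solution_of_not_shuttled s (hM' ▸ hM)
      fun h' => hS ((shuttled_congr h le_rfl).2 h'), discount_congr r h, pos_congr h le_rfl,
      postVal_congr fun k hk => hW k (by omega)]

/-- The candidate, reduced by a factor `c` for every level above the running maximum. -/
noncomputable def wsol (r : ℕ → ℝ) (s : Control N E) (c : ℝ) (n : ℕ) (ω : Path N E) : ℝ :=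
  c ^ (N - runMax n ω) * solution r s n ω

open Classical in
/-- The value of `wsol` at time `n + 1` if the process moves to `x` at that time. -/
noncomputable def stepVal (r : ℕ → ℝ) (s : Control N E) (c : ℝ) (n : ℕ) (ω : Path N E) (x : ℕ) :
    ℝ :=
  discount r n ω * if Shuttled n ω then 1 else r (pos n ω) *
    if runMax n ω < N then c ^ (N - max (runMax n ω) x) *
      (preVal N r (s.W ω) x * psiHat N r (s.W ω) (max (runMax n ω) x))
    else postVal N r (s.W ω) x

/-- One step of the candidate. At the turning time and at the shuttle time this uses that the value
functions of consecutive phases fit together. -/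
lemma wsol_succ (hr : ∀ x ≤ N, 0 ≤ r x ∧ r x ≤ 1) (s : Control N E) (c : ℝ) (n : ℕ)
    (ω : Path N E) : wsol r s c (n + 1) ω = stepVal r s c n ω (pos (n + 1) ω) := by
  classical
  unfold wsol stepVal
  by_cases hS : Shuttled n ω
  · have hS' := hS.mono n.le_succ
    rw [if_pos hS, mul_one, solution_of_shuttled hr s hS', discount_succ, if_pos hS, mul_one,
      hS'.runMax_eq, Nat.sub_self, pow_zero, one_mul]
  rw [if_neg hS]
  rcases (runMax_le n ω).lt_or_eq with hM | hM
  · rw [if_pos hM]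
    have hS' := not_shuttled_succ hM
    rw [← runMax_succ]
    rcases (runMax_le (n + 1) ω).lt_or_eq with hM' | hM'
    · rw [solution_of_lt s hM', discount_succ, if_neg hS]; ring
    · have hx : pos (n + 1) ω = N := by rw [runMax_succ] at hM'; omega
      rw [solution_of_not_shuttled s hM' hS', discount_succ, if_neg hS, hM', hx,
        preVal_mul_psiHat_top hr (s.W_pos ω), Nat.sub_self]; ring
  · rw [if_neg hM.not_lt]
    have hM' : runMax (n + 1) ω = N := by rw [runMax_succ, hM, max_eq_left (pos_le _ _)]
    rw [hM', Nat.sub_self, pow_zero, one_mul]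
    by_cases hS' : Shuttled (n + 1) ω
    · obtain ⟨j, hj, h0, m, hm, hmN⟩ := id hS'
      have hj' : j = n + 1 := by
        by_contra hne
        exact hS ⟨j, by omega, h0, m, hm, hmN⟩
      subst hj'
      have := one_le_tildeG hr (s.W_pos ω) (y := 0)
      rw [solution_of_shuttled hr s hS', h0, postVal_zero (by positivity), discount_succ, if_neg hS,
        mul_one]
    · rw [solution_of_not_shuttled s hM' hS', discount_succ, if_neg hS]; ring

lemma stepVal_mem (hr : ∀ x ≤ N, 0 ≤ r x ∧ r x ≤ 1) (s : Control N E) {c : ℝ} (hc : 0 ≤ c)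
    (hc1 : c ≤ 1) (n : ℕ) (ω : Path N E) {x : ℕ} (hx : x ≤ N) :
    0 ≤ stepVal r s c n ω x ∧ stepVal r s c n ω x ≤ 1 := by
  have hd := discount_mem hr n ω
  have hrx := hr _ (pos_le n ω)
  have h1 := mul_nonneg (preVal_nonneg hr (s.W_pos ω) hx)
      (psiHat_nonneg (N := N) (r := r) (W := s.W ω) (max (runMax n ω) x))
  have h2 := preVal_mul_psiHat_le_one hr (s.W_pos ω) (le_max_right (runMax n ω) x)
    (max_le (runMax_le n ω) hx)
  have h3 := postVal_mem hr (s.W_pos ω) hx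
  have hcp := pow_nonneg hc (N - max (runMax n ω) x)
  have hcp1 := pow_le_one₀ hc hc1 (n := N - max (runMax n ω) x)
  unfold stepVal
  split_ifs
  · rwa [mul_one]
  · exact ⟨by have := hrx.1; have := hd.1; positivity, mul_le_one₀ hd.2
      (mul_nonneg hrx.1 (mul_nonneg hcp h1)) (mul_le_one₀ hrx.2 (mul_nonneg hcp h1)
        (mul_le_one₀ hcp1 h1 h2))⟩
  · exact ⟨mul_nonneg hd.1 (mul_nonneg hrx.1 h3.1), mul_le_one₀ hd.2 (mul_nonneg hrx.1 h3.1)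
      (mul_le_one₀ hrx.2 h3.1 h3.2)⟩

lemma stepVal_congr (s : Control N E) (c : ℝ) (h : ∀ i ≤ n, ω i = ω' i) (hω : IsWalk n ω)
    {x : ℕ} (hx : x ≤ runMax n ω + 1) : stepVal r s c n ω x = stepVal r s c n ω' x := by
  have hM' := runMax_congr h
  have hW : ∀ k ≤ runMax n ω, s.W ω k = s.W ω' k := fun k hk => s.W_congr h hω hk
  unfold stepVal
  rw [← discount_congr r h, ← hM', ← pos_congr h le_rfl]
  by_cases hS : Shuttled n ω
  · rw [if_pos hS, if_pos ((shuttled_congr h le_rfl).1 hS)]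
  rw [if_neg hS, if_neg fun h' => hS ((shuttled_congr h le_rfl).2 h')]
  split_ifs with h2
  · rw [preVal_congr (W' := s.W ω') fun k hk => hW k (by omega),
      psiHat_congr (W' := s.W ω') fun k hk => hW k (by omega)]
  · rw [postVal_congr (W' := s.W ω') fun k hk => hW k (by omega)]

/-- The probability of a step up from `x` for ratios `w`. -/
noncomputable def upProb (N : ℕ) (w : ℕ → ℝ) (x : ℕ) : ℝ :=
  if x = 0 then 1 else if x = N then 0 else 1 / (1 + w x)

/-- On the way up the value is harmonic for the discounted process. -/
lemma preVal_balance {W w : ℕ → ℝ} (hw : ∀ x, 0 < w x) (hW0 : ∀ x, 0 < W x)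
    (hW : ∀ x, W (x + 1) = W x * w (x + 1)) {x : ℕ} (hx : x < N) :
    r x * (upProb N w x * preVal N r W (x + 1) + (1 - upProb N w x) * preVal N r W (x - 1)) =
      preVal N r W x := by
  rcases x with _ | x
  · rw [upProb, if_pos rfl, preVal_zero hx]; ring
  · rw [upProb, if_neg (by omega), if_neg hx.ne, Nat.add_sub_cancel]
    exact preVal_harmonic (hw _) hx (hW0 x).ne' (hW x)

/-- On the way down the value is harmonic for the discounted process. -/
lemma postVal_balance {W w : ℕ → ℝ} (hw : ∀ x, 0 < w x) (hW0 : ∀ x, 0 < W x)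
    (hW : ∀ x, W (x + 1) = W x * w (x + 1)) {x : ℕ} (hx0 : x ≠ 0) (hx : x ≤ N) :
    r x * (upProb N w x * postVal N r W (min (x + 1) N) +
      (1 - upProb N w x) * postVal N r W (x - 1)) = postVal N r W x := by
  rcases hx.lt_or_eq with hx' | rfl
  · obtain ⟨x, rfl⟩ := Nat.exists_eq_succ_of_ne_zero hx0
    rw [upProb, if_neg hx0, if_neg hx'.ne, min_eq_left hx']
    exact postVal_harmonic (hw _) hx' (hW0 x).ne' (hW x)
  · rw [upProb, if_neg hx0, if_pos rfl, postVal_top (by omega)]; ring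

/-- The conditional mean of `wsol` at time `n + 1`. -/
noncomputable def stepMean (r : ℕ → ℝ) (s : Control N E) (c : ℝ) (n : ℕ) (ω : Path N E) : ℝ :=
  upProb N (s.w · ω) (pos n ω) * stepVal r s c n ω (min (pos n ω + 1) N) +
    (1 - upProb N (s.w · ω) (pos n ω)) * stepVal r s c n ω (pos n ω - 1)

/-- Before the turning time, the conditional mean changes only through the increase of the running
maximum. -/
lemma stepMean_of_lt (s : Control N E) (c : ℝ) (hM : runMax n ω < N) :
    stepMean r s c n ω = wsol r s c n ω +
      discount r n ω * r (pos n ω) * upProb N (s.w · ω) (pos n ω) *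
        preVal N r (s.W ω) (pos n ω + 1) *
        (c ^ (N - max (runMax n ω) (pos n ω + 1)) *
            psiHat N r (s.W ω) (max (runMax n ω) (pos n ω + 1)) -
          c ^ (N - runMax n ω) * psiHat N r (s.W ω) (runMax n ω)) := by
  have hx := pos_le_runMax le_rfl ω (n := n)
  have hb := preVal_balance (N := N) (r := r) (fun x => s.pos_w x ω) (s.W_pos ω) (s.W_succ ω)
    (hx.trans_lt hM)
  have h1 : min (pos n ω + 1) N = pos n ω + 1 := min_eq_left (by omega)
  have h2 : max (runMax n ω) (pos n ω - 1) = runMax n ω := max_eq_left (by omega)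
  unfold stepMean stepVal wsol
  rw [if_neg (not_shuttled hM), if_neg (not_shuttled hM), if_pos hM, if_pos hM, h1, h2,
    solution_of_lt s hM, ← hb]
  ring

lemma stepMean_of_eq (hN : 1 ≤ N) (hr : ∀ x ≤ N, 0 ≤ r x ∧ r x ≤ 1) (s : Control N E) (c : ℝ)
    (hM : runMax n ω = N) : stepMean r s c n ω = wsol r s c n ω := by
  unfold stepMean stepVal wsol
  rw [hM, Nat.sub_self, pow_zero, one_mul]
  by_cases hS : Shuttled n ω
  · rw [if_pos hS, if_pos hS, solution_of_shuttled hr s hS]; ring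
  · have hb := postVal_balance (N := N) (r := r) (fun x => s.pos_w x ω) (s.W_pos ω) (s.W_succ ω)
      (pos_ne_zero hN hS hM) (pos_le n ω)
    rw [if_neg hS, if_neg hS, if_neg (lt_irrefl N), if_neg (lt_irrefl N),
      solution_of_not_shuttled s hM hS, ← hb]
    ring

lemma stepMean_coeff_nonneg (hr : ∀ x ≤ N, 0 ≤ r x ∧ r x ≤ 1) (s : Control N E)
    (hM : runMax n ω < N) : 0 ≤ discount r n ω * r (pos n ω) * upProb N (s.w · ω) (pos n ω) *
        preVal N r (s.W ω) (pos n ω + 1) := by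
  have hx := pos_le_runMax le_rfl ω (n := n)
  have h1 := preVal_nonneg hr (s.W_pos ω) (x := pos n ω + 1) (by omega)
  have h2 : 0 ≤ upProb N (s.w · ω) (pos n ω) := by
    have := s.pos_w (pos n ω) ω
    unfold upProb
    split_ifs <;> positivity
  exact mul_nonneg (mul_nonneg (mul_nonneg (discount_mem hr n ω).1 (hr _ (pos_le n ω)).1) h2) h1

/-- For every control the candidate is a supermartingale, since `ψ̂` decreases. -/
lemma stepMean_le (hN : 1 ≤ N) (hr : ∀ x ≤ N, 0 ≤ r x ∧ r x ≤ 1) (s : Control N E) (n : ℕ)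
    (ω : Path N E) : stepMean r s 1 n ω ≤ wsol r s 1 n ω := by
  rcases (runMax_le n ω).lt_or_eq with hM | hM
  · rw [stepMean_of_lt s 1 hM]
    have h := stepMean_coeff_nonneg hr s hM
    have hx := pos_le_runMax le_rfl ω (n := n)
    have h2 : psiHat N r (s.W ω) (max (runMax n ω) (pos n ω + 1)) ≤
        psiHat N r (s.W ω) (runMax n ω) := by
      rcases hx.lt_or_eq with hx' | hx'
      · rw [max_eq_left (by omega)]
      · rw [hx', max_eq_right (by omega)]; exact psiHat_succ_le hr (s.W_pos ω) hM
    simp only [one_pow, one_mul]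
    nlinarith
  · rw [stepMean_of_eq hN hr s 1 hM]

/-- If `ψ̂` loses at most a factor `c` per level, then `wsol` is a submartingale. -/
lemma le_stepMean (hN : 1 ≤ N) (hr : ∀ x ≤ N, 0 ≤ r x ∧ r x ≤ 1) (s : Control N E) {c : ℝ}
    (hc : 0 ≤ c) (h : runMax n ω < N →
      c * psiHat N r (s.W ω) (runMax n ω) ≤ psiHat N r (s.W ω) (runMax n ω + 1)) :
    wsol r s c n ω ≤ stepMean r s c n ω := by
  rcases (runMax_le n ω).lt_or_eq with hM | hM
  · rw [stepMean_of_lt s c hM]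
    have h' := stepMean_coeff_nonneg hr s hM
    have hx := pos_le_runMax le_rfl ω (n := n)
    have h2 : c ^ (N - runMax n ω) * psiHat N r (s.W ω) (runMax n ω) ≤
        c ^ (N - max (runMax n ω) (pos n ω + 1)) *
            psiHat N r (s.W ω) (max (runMax n ω) (pos n ω + 1)) := by
      rcases hx.lt_or_eq with hx' | hx'
      · rw [max_eq_left (by omega)]
      · rw [hx', max_eq_right (by omega), show N - runMax n ω = N - (runMax n ω + 1) + 1 by omega,
          pow_succ, mul_assoc]
        exact mul_le_mul_of_nonneg_left (h hM) (pow_nonneg hc _)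
    nlinarith
  · rw [stepMean_of_eq hN hr s c hM]

end Values

section Law

variable {N : ℕ} {E : Type*} [MeasurableSpace E] {n : ℕ} {ω : Path N E}

/-! ### Measurability -/

lemma measurable_pos (n : ℕ) : Measurable (pos n : Path N E → ℕ) :=
  (measurable_of_countable (fun x : Fin (N + 1) => (x : ℕ))).comp
    (measurable_snd.comp (measurable_pi_apply n))

lemma measurableSet_pos (n x : ℕ) : MeasurableSet {ω : Path N E | pos n ω = x} :=
  measurable_pos n (measurableSet_singleton x)

lemma measurable_runMax (n : ℕ) : Measurable (runMax n : Path N E → ℕ) := by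
  induction n with
  | zero =>
    have : (runMax 0 : Path N E → ℕ) = pos 0 := funext runMax_zero
    rw [this]; exact measurable_pos 0
  | succ n ih =>
    have : (runMax (n + 1) : Path N E → ℕ) = fun ω => max (runMax n ω) (pos (n + 1) ω) :=
      funext (runMax_succ n)
    rw [this]; exact ih.max (measurable_pos _)

lemma measurableSet_shuttled (n : ℕ) : MeasurableSet {ω : Path N E | Shuttled n ω} := by
  have : {ω : Path N E | Shuttled n ω} =
      ⋃ j ∈ Set.Iic n, {ω | pos j ω = 0} ∩ ⋃ m ∈ Set.Iio j, {ω | pos m ω = N} := by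
    ext ω; simp [Shuttled, and_left_comm]
  rw [this]
  exact MeasurableSet.biUnion (Set.to_countable _) fun j _ => (measurableSet_pos j 0).inter
    (MeasurableSet.biUnion (Set.to_countable _) fun m _ => measurableSet_pos m N)

/-- Measurability of a sequence of measurable functions at a random index. -/
lemma measurable_apply_nat {Ω : Type*} [MeasurableSpace Ω] {f : ℕ → Ω → ℝ} {k : Ω → ℕ}
    (hf : ∀ n, Measurable (f n)) (hk : Measurable k) : Measurable fun ω => f (k ω) ω :=
  (measurable_from_prod_countable_right (f := fun q : ℕ × Ω => f q.1 q.2) hf).comp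
    (hk.prodMk measurable_id)

lemma measurable_discount (r : ℕ → ℝ) (n : ℕ) : Measurable (discount r n : Path N E → ℝ) := by
  classical
  induction n with
  | zero =>
    have : (discount r 0 : Path N E → ℝ) = fun _ => 1 := by funext ω; simp [discount]
    rw [this]; exact measurable_const
  | succ n ih =>
    have : (discount r (n + 1) : Path N E → ℝ) = fun ω => discount r n ω *
        if Shuttled n ω then 1 else r (pos n ω) := funext (discount_succ r n)
    rw [this]
    exact ih.mul (Measurable.ite (measurableSet_shuttled n) measurable_const
      ((measurable_of_countable r).comp (measurable_pos n)))

lemma measurable_payoff (r : ℕ → ℝ) : Measurable (payoff r : Path N E → ℝ) :=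
  Measurable.iInf fun n => measurable_discount r n

lemma Control.measurable_W (s : Control N E) (k : ℕ) : Measurable fun ω => s.W ω k :=
  Finset.measurable_fun_prod _ fun j _ => s.measurable_w j

lemma measurable_chainSum {Ω : Type*} [MeasurableSpace Ω] {α β : Ω → ℕ → ℝ}
    (hα : ∀ i, Measurable fun ω => α ω i) (hβ : ∀ i, Measurable fun ω => β ω i) (k a b : ℕ) :
    Measurable fun ω => chainSum (α ω) (β ω) k a b := by
  unfold chainSum
  refine Finset.measurable_fun_sum _ fun c _ => Finset.measurable_fun_prod _ fun i _ => ?_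
  split_ifs
  exacts [hα i, hβ i]

lemma measurable_evenChains {Ω : Type*} [MeasurableSpace Ω] {α β : Ω → ℕ → ℝ}
    (hα : ∀ i, Measurable fun ω => α ω i) (hβ : ∀ i, Measurable fun ω => β ω i) (N a b : ℕ) :
    Measurable fun ω => evenChains N (α ω) (β ω) a b :=
  Finset.measurable_fun_sum _ fun _ _ => measurable_chainSum hα hβ _ _ _

lemma measurable_oddChains {Ω : Type*} [MeasurableSpace Ω] {α β : Ω → ℕ → ℝ}
    (hα : ∀ i, Measurable fun ω => α ω i) (hβ : ∀ i, Measurable fun ω => β ω i) (N a b : ℕ) :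
    Measurable fun ω => oddChains N (α ω) (β ω) a b :=
  Finset.measurable_fun_sum _ fun _ _ => measurable_chainSum hα hβ _ _ _

section
variable {Ω : Type*} [MeasurableSpace Ω] {W : Ω → ℕ → ℝ} (hW : ∀ i, Measurable fun ω => W ω i)
  (r : ℕ → ℝ)
include hW

lemma measurable_uWeight (i : ℕ) : Measurable fun ω => uWeight r (W ω) i :=
  measurable_const.div (hW i)

lemma measurable_calG (x : ℕ) : Measurable fun ω => calG N r (W ω) x :=
  measurable_evenChains (measurable_uWeight hW r) hW N 0 x

lemma measurable_deltaG (x : ℕ) : Measurable fun ω => deltaG N r (W ω) x :=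
  measurable_oddChains (measurable_uWeight hW r) hW N 0 x

lemma measurable_tildeGStar (x : ℕ) : Measurable fun ω => tildeGStar N r (W ω) x :=
  measurable_evenChains hW (measurable_uWeight hW r) N 0 x

lemma measurable_deltaTildeGStar (x : ℕ) : Measurable fun ω => deltaTildeGStar N r (W ω) x :=
  measurable_oddChains hW (measurable_uWeight hW r) N 0 x

lemma measurable_tildeG (x : ℕ) : Measurable fun ω => tildeG N r (W ω) x :=
  measurable_evenChains hW (measurable_uWeight hW r) N x N

lemma measurable_psiHat (y : ℕ) : Measurable fun ω => psiHat N r (W ω) y := by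
  have h1 := ((measurable_calG (N := N) hW r y).mul (measurable_tildeGStar (N := N) hW r y)).sqrt
  have h2 := ((measurable_deltaG (N := N) hW r y).mul
    (measurable_deltaTildeGStar (N := N) hW r y)).sqrt
  exact (((h1.mul_const _).add (h2.mul_const _)).pow_const 2).inv

lemma measurable_preVal (x : ℕ) : Measurable fun ω => preVal N r (W ω) x :=
  (measurable_calG hW r x).const_mul _

lemma measurable_postVal (x : ℕ) : Measurable fun ω => postVal N r (W ω) x :=
  ((measurable_tildeG hW r x).div (measurable_tildeG hW r 0)).const_mul _

end

lemma measurable_stepVal (r : ℕ → ℝ) (s : Control N E) (c : ℝ) (n x : ℕ) :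
    Measurable fun ω => stepVal r s c n ω x := by
  classical
  unfold stepVal
  have hM := measurable_runMax (N := N) (E := E) n
  have hmax : Measurable fun ω : Path N E => max (runMax n ω) x := hM.max measurable_const
  refine (measurable_discount r n).mul (Measurable.ite (measurableSet_shuttled n) measurable_const
    (((measurable_of_countable r).comp (measurable_pos n)).mul (Measurable.ite
      (hM (measurableSet_Iio (a := N))) ?_ (measurable_postVal s.measurable_W r x))))
  exact ((measurable_of_countable fun m : ℕ => c ^ (N - m)).comp hmax).mul
    ((measurable_preVal s.measurable_W r x).mul
      (measurable_apply_nat (measurable_psiHat s.measurable_W r) hmax))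

lemma measurable_solution {r : ℕ → ℝ} (hr : ∀ x ≤ N, 0 ≤ r x ∧ r x ≤ 1) (s : Control N E)
    (n : ℕ) : Measurable (solution r s n) := by
  classical
  have hM := measurable_runMax (N := N) (E := E) n
  have : solution r s n = fun ω => discount r n ω * if Shuttled n ω then 1 else
      if runMax n ω < N then preVal N r (s.W ω) (pos n ω) * psiHat N r (s.W ω) (runMax n ω)
      else postVal N r (s.W ω) (pos n ω) := by
    funext ω
    by_cases hS : Shuttled n ω
    · rw [if_pos hS, mul_one, solution_of_shuttled hr s hS]
    rw [if_neg hS]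
    rcases (runMax_le n ω).lt_or_eq with hM | hM
    · rw [if_pos hM, solution_of_lt s hM]
    · rw [if_neg hM.not_lt, solution_of_not_shuttled s hM hS]
  rw [this]
  exact (measurable_discount r n).mul (Measurable.ite (measurableSet_shuttled n) measurable_const
    (Measurable.ite (hM (measurableSet_Iio (a := N)))
      ((measurable_apply_nat (measurable_preVal s.measurable_W r) (measurable_pos n)).mul
        (measurable_apply_nat (measurable_psiHat s.measurable_W r) hM))
      (measurable_apply_nat (measurable_postVal s.measurable_W r) (measurable_pos n))))

lemma measurable_wsol {r : ℕ → ℝ} (hr : ∀ x ≤ N, 0 ≤ r x ∧ r x ≤ 1) (s : Control N E) (c : ℝ)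
    (n : ℕ) : Measurable (wsol r s c n) :=
  ((measurable_of_countable fun m : ℕ => c ^ (N - m)).comp (measurable_runMax n)).mul
    (measurable_solution hr s n)

lemma Control.measurable_upProb (s : Control N E) (n : ℕ) :
    Measurable fun ω => upProb N (s.w · ω) (pos n ω) := by
  refine measurable_apply_nat (f := fun x ω => upProb N (s.w · ω) x) (fun x => ?_)
    (measurable_pos n)
  unfold upProb
  split_ifs
  · exact measurable_const
  · exact measurable_const
  · exact measurable_const.div (measurable_const.add (s.measurable_w x))

lemma Control.upProb_mem (s : Control N E) (ω : Path N E) (x : ℕ) :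
    0 ≤ upProb N (s.w · ω) x ∧ upProb N (s.w · ω) x ≤ 1 := by
  have := s.pos_w x ω
  unfold upProb
  split_ifs
  · simp
  · simp
  · exact ⟨by positivity, by rw [div_le_one (by positivity)]; linarith⟩

lemma filt_eq (n : ℕ) : (filt N E n : MeasurableSpace (Path N E)) =
    MeasurableSpace.pi.comap (Preorder.frestrictLe (π := fun _ : ℕ => Obs N E) n) :=
  Filtration.piLE_eq_comap_frestrictLe n

lemma measurable_freeze_filt (n : ℕ) :
    Measurable[filt N E n] (freeze n : Path N E → Path N E) := by
  rw [filt_eq]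
  exact measurable_extend.comp (comap_measurable _)

lemma measurable_freeze (n : ℕ) : Measurable (freeze n : Path N E → Path N E) :=
  (measurable_freeze_filt n).mono ((filt N E).le n) le_rfl

lemma freeze_mem_iff {A : Set (Path N E)} (hA : MeasurableSet[filt N E n] A) (ω : Path N E) :
    freeze n ω ∈ A ↔ ω ∈ A := by
  rw [filt_eq] at hA
  obtain ⟨B, -, rfl⟩ := hA
  simp only [Set.mem_preimage]
  have : Preorder.frestrictLe (π := fun _ : ℕ => Obs N E) n (freeze n ω) =
      Preorder.frestrictLe (π := fun _ : ℕ => Obs N E) n ω :=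
    funext fun i => freeze_apply (Finset.mem_Iic.1 i.2) ω
  rw [this]

/-! ### The one-step transition -/

variable (ν : Measure E) [IsProbabilityMeasure ν]

lemma law_map_compProd (s : Control N E) (n : ℕ) :
    (s.law ν).map (Preorder.frestrictLe (π := fun _ : ℕ => Obs N E) n) ⊗ₘ s.step ν n =
      (s.law ν).map fun ω => (Preorder.frestrictLe (π := fun _ : ℕ => Obs N E) n ω, ω (n + 1)) :=
  Kernel.map_frestrictLe_trajMeasure_compProd_eq_map_trajMeasure

lemma law_map_compProd_move (s : Control N E) (n : ℕ) :
    (s.law ν).map (Preorder.frestrictLe (π := fun _ : ℕ => Obs N E) n) ⊗ₘ s.move n =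
      (s.law ν).map fun ω =>
        (Preorder.frestrictLe (π := fun _ : ℕ => Obs N E) n ω, (ω (n + 1)).2) := by
  have h1 : (s.step ν n).map Prod.snd = s.move n := by
    rw [← Kernel.snd_eq, Control.step, Kernel.snd_prod]
  rw [← h1, Measure.compProd_map measurable_snd, law_map_compProd, Measure.map_map]
  · rfl
  · fun_prop
  · exact (Preorder.measurable_frestrictLe n).prodMk (measurable_pi_apply _)

lemma integral_move (s : Control N E) (h : Hist N E n) (g : Fin (N + 1) → ℝ) :
    ∫ x, g x ∂(s.move n h) =
      s.up h * g (above (lastPos h)) + (1 - s.up h) * g (below (lastPos h)) := by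
  have hu := s.up_mem h
  change ∫ x, g x ∂(ENNReal.ofReal (s.up h) • Measure.dirac (above (lastPos h)) +
    ENNReal.ofReal (1 - s.up h) • Measure.dirac (below (lastPos h)) : Measure _) = _
  rw [integral_add_measure, integral_smul_measure, integral_smul_measure, integral_dirac,
    integral_dirac, ENNReal.toReal_ofReal hu.1, ENNReal.toReal_ofReal (by linarith [hu.2])]
  · rfl
  all_goals exact (Integrable.of_finite).smul_measure ENNReal.ofReal_ne_top

/-- The Markov property of one step, for functions of the history and the next position. -/
lemma integral_next (s : Control N E) (n : ℕ) {g : Fin (N + 1) → Path N E → ℝ}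
    (hg : ∀ x, Measurable (g x)) {C : ℝ} (hC : ∀ x ω, |g x ω| ≤ C) :
    ∫ ω, g (ω (n + 1)).2 (freeze n ω) ∂(s.law ν) =
      ∫ ω, (upProb N (s.w · (freeze n ω)) (pos n ω) * g (above (ω n).2) (freeze n ω) +
        (1 - upProb N (s.w · (freeze n ω)) (pos n ω)) * g (below (ω n).2) (freeze n ω))
          ∂(s.law ν) := by
  have hG : Measurable fun q : Hist N E n × Fin (N + 1) => g q.2 (extend q.1) :=
    (measurable_from_prod_countable_right (f := fun q : Fin (N + 1) × Hist N E n =>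
      g q.1 (extend q.2)) fun x => (hg x).comp measurable_extend).comp measurable_swap
  have hr := Preorder.measurable_frestrictLe (X := fun _ : ℕ => Obs N E) n
  have hpair : Measurable fun ω : Path N E =>
      (Preorder.frestrictLe (π := fun _ : ℕ => Obs N E) n ω, (ω (n + 1)).2) :=
    hr.prodMk (measurable_snd.comp (measurable_pi_apply _))
  have hprob : IsProbabilityMeasure
      ((s.law ν).map (Preorder.frestrictLe (π := fun _ : ℕ => Obs N E) n)) :=
    Measure.isProbabilityMeasure_map hr.aemeasurable
  have hint : Integrable (fun q : Hist N E n × Fin (N + 1) => g q.2 (extend q.1))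
      ((s.law ν).map (Preorder.frestrictLe (π := fun _ : ℕ => Obs N E) n) ⊗ₘ s.move n) :=
    Integrable.of_bound hG.aestronglyMeasurable C (ae_of_all _ fun q => hC _ _)
  have h1 := integral_map (μ := s.law ν) hpair.aemeasurable hG.aestronglyMeasurable
  have h2 := Measure.integral_compProd hint
  rw [law_map_compProd_move, h1] at h2
  refine h2.trans ?_
  simp only [integral_move]
  rw [integral_map hr.aemeasurable]
  · rfl
  · refine Measurable.aestronglyMeasurable ?_
    have ha : ∀ f : Fin (N + 1) → Fin (N + 1),
        Measurable fun h : Hist N E n => g (f (lastPos h)) (extend h) := fun f =>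
      hG.comp (measurable_id.prodMk ((measurable_of_countable f).comp measurable_lastPos))
    exact (s.measurable_up.mul (ha above)).add
      ((measurable_const.sub s.measurable_up).mul (ha below))

/-- The conditional form of `integral_next`: integrals over an event of the history. -/
lemma setIntegral_next (s : Control N E) {g : Fin (N + 1) → Path N E → ℝ}
    (hg : ∀ x, Measurable (g x)) {C : ℝ} (hC : ∀ x ω, |g x ω| ≤ C) {A : Set (Path N E)}
    (hA : MeasurableSet[filt N E n] A) :
    ∫ ω in A, g (ω (n + 1)).2 (freeze n ω) ∂(s.law ν) =
      ∫ ω in A, (upProb N (s.w · (freeze n ω)) (pos n ω) * g (above (ω n).2) (freeze n ω) +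
        (1 - upProb N (s.w · (freeze n ω)) (pos n ω)) * g (below (ω n).2) (freeze n ω))
          ∂(s.law ν) := by
  have hA' := (filt N E).le n A hA
  rw [← integral_indicator hA', ← integral_indicator hA']
  have h := integral_next ν s n (g := fun x => A.indicator (g x)) (C := C)
    (fun x => (hg x).indicator hA') fun x ω => by
      by_cases hω : ω ∈ A
      · rw [Set.indicator_of_mem hω]; exact hC x ω
      · rw [Set.indicator_of_notMem hω, abs_zero]; exact (abs_nonneg _).trans (hC x ω)
  convert h using 2
  · funext ω
    by_cases hω : ω ∈ A
    · rw [Set.indicator_of_mem hω, Set.indicator_of_mem ((freeze_mem_iff hA ω).2 hω)]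
    · rw [Set.indicator_of_notMem hω, Set.indicator_of_notMem (mt (freeze_mem_iff hA ω).1 hω)]
  · funext ω
    by_cases hω : ω ∈ A
    · have hω' := (freeze_mem_iff hA ω).2 hω
      rw [Set.indicator_of_mem hω, Set.indicator_of_mem hω', Set.indicator_of_mem hω']
    · have hω' := mt (freeze_mem_iff hA ω).1 hω
      rw [Set.indicator_of_notMem hω, Set.indicator_of_notMem hω', Set.indicator_of_notMem hω']
      ring

lemma law_map_zero (s : Control N E) :
    (s.law ν).map (Preorder.frestrictLe (π := fun _ : ℕ => Obs N E) 0) =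
      (ν.prod (Measure.dirac (0 : Fin (N + 1)))).map
        (MeasurableEquiv.piUnique fun _ : Finset.Iic 0 => Obs N E).symm := by
  rw [Control.law, Kernel.trajMeasure, Measure.map_comp _ _ (by fun_prop),
    Kernel.traj_map_frestrictLe, Kernel.partialTraj_self, Measure.id_comp]

end Law

section

variable {N : ℕ} {E : Type*} [MeasurableSpace E] {n : ℕ} {ω : Path N E}
  (ν : Measure E) [IsProbabilityMeasure ν]

/-! ### Almost sure properties of the controlled process -/

lemma ae_pos_zero (s : Control N E) : ∀ᵐ ω ∂(s.law ν), pos 0 ω = 0 := by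
  have hr := Preorder.measurable_frestrictLe (X := fun _ : ℕ => Obs N E) 0
  have h : ∀ᵐ h ∂((s.law ν).map (Preorder.frestrictLe (π := fun _ : ℕ => Obs N E) 0)),
      lastPos h = 0 := by
    have hm : MeasurableSet {h : Hist N E 0 | lastPos h = 0} :=
      measurable_lastPos (measurableSet_singleton _)
    rw [law_map_zero, ae_map_iff (MeasurableEquiv.measurable _).aemeasurable hm]
    have h1 : ∀ᵐ q ∂(ν.prod (Measure.dirac (0 : Fin (N + 1)))), q.2 = 0 := by
      have h2 : ∀ᵐ x ∂((ν.prod (Measure.dirac (0 : Fin (N + 1)))).map Prod.snd), x = 0 := by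
        rw [Measure.map_snd_prod, measure_univ, one_smul]
        exact (ae_dirac_iff (measurableSet_singleton _)).2 rfl
      exact ae_of_ae_map measurable_snd.aemeasurable h2
    exact h1
  filter_upwards [ae_of_ae_map hr.aemeasurable h] with ω hω
  have h2 : (ω 0).2 = 0 := hω
  simp [pos, h2]

lemma above_val {x : Fin (N + 1)} : (above x : ℕ) = min ((x : ℕ) + 1) N := rfl

lemma below_val {x : Fin (N + 1)} : (below x : ℕ) = (x : ℕ) - 1 := rfl

lemma upProb_zero (w : ℕ → ℝ) : upProb N w 0 = 1 := if_pos rfl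

lemma upProb_top (hN : 1 ≤ N) (w : ℕ → ℝ) : upProb N w N = 0 := by
  rw [upProb, if_neg (by omega), if_pos rfl]

lemma ae_step (hN : 1 ≤ N) (s : Control N E) (n : ℕ) : ∀ᵐ ω ∂(s.law ν),
    pos (n + 1) ω = pos n ω + 1 ∨ pos (n + 1) ω + 1 = pos n ω := by
  classical
  set B : Set (Path N E) :=
    {ω | pos (n + 1) ω = pos n ω + 1 ∨ pos (n + 1) ω + 1 = pos n ω} with hB
  have hBm : MeasurableSet B := by
    have h : B = ⋃ x : ℕ, ⋃ y ∈ {y : ℕ | y = x + 1 ∨ y + 1 = x},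
        {ω | pos n ω = x} ∩ {ω | pos (n + 1) ω = y} := by
      ext ω; simp [hB, ← and_or_left]
    rw [h]
    exact MeasurableSet.iUnion fun x => MeasurableSet.biUnion (Set.to_countable _) fun y _ =>
      (measurableSet_pos n x).inter (measurableSet_pos (n + 1) y)
  -- the indicator of a step to `y` that is not between nearest neighbours
  let f : Fin (N + 1) → Path N E → ℝ := fun y ω =>
    if (y : ℕ) = pos n ω + 1 ∨ (y : ℕ) + 1 = pos n ω then 0 else 1
  have hf : ∀ y, Measurable (f y) := fun y =>
    (measurable_of_countable fun x : ℕ =>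
      if (y : ℕ) = x + 1 ∨ (y : ℕ) + 1 = x then (0 : ℝ) else 1).comp (measurable_pos n)
  have h := integral_next ν s n hf (C := 1) fun y ω => by
    simp only [f]; split_ifs <;> simp
  have h0 : ∀ ω : Path N E, upProb N (s.w · (freeze n ω)) (pos n ω) *
        f (above (ω n).2) (freeze n ω) + (1 - upProb N (s.w · (freeze n ω)) (pos n ω)) *
        f (below (ω n).2) (freeze n ω) = 0 := by
    intro ω
    have hp : pos n (freeze n ω) = pos n ω := pos_congr (fun i hi => freeze_apply hi ω) le_rfl
    have hx := pos_le n ω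
    have e : ((ω n).2 : ℕ) = pos n ω := rfl
    simp only [f, hp, above_val, below_val, e]
    by_cases h0 : pos n ω = 0
    · rw [h0, upProb_zero, if_pos (Or.inl (by omega))]; ring
    by_cases h1 : pos n ω = N
    · rw [h1, upProb_top hN, if_pos (Or.inr (by omega) : N - 1 = N + 1 ∨ N - 1 + 1 = N)]; ring
    · rw [if_pos (Or.inl (by omega)), if_pos (Or.inr (by omega))]; ring
  simp only [h0, integral_zero] at h
  have hi : ∀ ω : Path N E, f (ω (n + 1)).2 (freeze n ω) = Bᶜ.indicator (fun _ => (1 : ℝ)) ω := by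
    intro ω
    have hp : pos n (freeze n ω) = pos n ω := pos_congr (fun i hi => freeze_apply hi ω) le_rfl
    simp only [f, hp, Set.indicator, hB, Set.mem_compl_iff, Set.mem_ofPred_eq]
    change (if pos (n + 1) ω = _ ∨ pos (n + 1) ω + 1 = _ then (0 : ℝ) else 1) = _
    split_ifs <;> simp_all
  simp only [hi] at h
  rw [integral_indicator hBm.compl, setIntegral_const, smul_eq_mul, mul_one,
    measureReal_eq_zero_iff] at h
  exact h

lemma ae_isWalk (hN : 1 ≤ N) (s : Control N E) : ∀ᵐ ω ∂(s.law ν), ∀ n, IsWalk n ω := by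
  filter_upwards [ae_pos_zero ν s, ae_all_iff.2 fun n => ae_step ν hN s n] with ω h0 h1 n
  exact ⟨h0, fun m _ => h1 m⟩

/-! ### Equivalence of the laws on finite histories -/

lemma upProb_eq_zero_iff {w : ℕ → ℝ} (hw : ∀ x, 0 < w x) (x : ℕ) :
    upProb N w x = 0 ↔ x ≠ 0 ∧ x = N := by
  have := hw x
  have h1 : 1 / (1 + w x) ≠ 0 := by positivity
  unfold upProb
  split_ifs <;> simp_all

lemma one_sub_upProb_eq_zero_iff {w : ℕ → ℝ} (hw : ∀ x, 0 < w x) (x : ℕ) :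
    1 - upProb N w x = 0 ↔ x = 0 := by
  have := hw x
  have h1 : 1 - 1 / (1 + w x) ≠ 0 := by
    rw [one_sub_div (by positivity)]; simp; constructor <;> positivity
  unfold upProb
  split_ifs <;> simp_all

lemma Control.up_eq (s : Control N E) (h : Hist N E n) :
    s.up h = upProb N (s.w · (extend h)) (lastPos h) := rfl

lemma move_absolutelyContinuous (s s' : Control N E) (h : Hist N E n) :
    s.move n h ≪ s'.move n h := by
  refine Measure.AbsolutelyContinuous.mk fun A _ hA => ?_
  change (ENNReal.ofReal (s'.up h) • Measure.dirac (above (lastPos h)) +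
    ENNReal.ofReal (1 - s'.up h) • Measure.dirac (below (lastPos h)) : Measure _) A = 0 at hA
  change (ENNReal.ofReal (s.up h) • Measure.dirac (above (lastPos h)) +
    ENNReal.ofReal (1 - s.up h) • Measure.dirac (below (lastPos h)) : Measure _) A = 0
  have hu := s.up_mem h
  have hu' := s'.up_mem h
  simp only [Measure.coe_add, Measure.coe_smul, Pi.add_apply, Pi.smul_apply, smul_eq_mul,
    add_eq_zero, mul_eq_zero, ENNReal.ofReal_eq_zero] at hA ⊢
  have e1 : s'.up h ≤ 0 ↔ s.up h ≤ 0 := by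
    rw [hu'.1.ge_iff_eq', hu.1.ge_iff_eq', s.up_eq, s'.up_eq,
      upProb_eq_zero_iff fun x => s.pos_w x _, upProb_eq_zero_iff fun x => s'.pos_w x _]
  have e2 : 1 - s'.up h ≤ 0 ↔ 1 - s.up h ≤ 0 := by
    rw [(sub_nonneg.2 hu'.2).ge_iff_eq', (sub_nonneg.2 hu.2).ge_iff_eq', s.up_eq, s'.up_eq,
      one_sub_upProb_eq_zero_iff fun x => s.pos_w x _,
      one_sub_upProb_eq_zero_iff fun x => s'.pos_w x _]
  rwa [e1, e2] at hA

lemma step_absolutelyContinuous (s s' : Control N E) (h : Hist N E n) :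
    s.step ν n h ≪ s'.step ν n h := by
  unfold Control.step
  rw [Kernel.prod_apply, Kernel.prod_apply]
  exact Measure.AbsolutelyContinuous.prod Measure.AbsolutelyContinuous.rfl
    (move_absolutelyContinuous s s' h)

/-- The laws of any two controls are equivalent on finite histories, since every control gives
positive probability to both moves in the interior. -/
lemma law_map_absolutelyContinuous (s s' : Control N E) (n : ℕ) :
    (s.law ν).map (Preorder.frestrictLe (π := fun _ : ℕ => Obs N E) n) ≪
      (s'.law ν).map (Preorder.frestrictLe (π := fun _ : ℕ => Obs N E) n) := by
  have hr := fun m => Preorder.measurable_frestrictLe (X := fun _ : ℕ => Obs N E) m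
  induction n with
  | zero => rw [law_map_zero, law_map_zero]
  | succ n ih =>
    -- `φ` appends an observation to a history
    let φ : Hist N E n × Obs N E → Hist N E (n + 1) := fun q i =>
      if h : (i : ℕ) ≤ n then q.1 ⟨i, Finset.mem_Iic.2 h⟩ else q.2
    have hφ : Measurable φ := by
      refine measurable_pi_lambda _ fun i => ?_
      by_cases h : (i : ℕ) ≤ n
      · simp only [φ, h, dite_true]
        exact (measurable_pi_apply _).comp measurable_fst
      · simp only [φ, h, dite_false]
        exact measurable_snd
    have hmap : ∀ s : Control N E,
        (s.law ν).map (Preorder.frestrictLe (π := fun _ : ℕ => Obs N E) (n + 1)) =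
        ((s.law ν).map (Preorder.frestrictLe (π := fun _ : ℕ => Obs N E) n) ⊗ₘ
          s.step ν n).map φ := by
      intro s
      rw [law_map_compProd, Measure.map_map hφ ((hr n).prodMk (measurable_pi_apply _))]
      congr 1
      funext ω i
      have hi := Finset.mem_Iic.1 i.2
      simp only [φ, Function.comp]
      split_ifs with h
      · rfl
      · have : (i : ℕ) = n + 1 := by omega
        change ω i = ω (n + 1)
        rw [this]
    rw [hmap s, hmap s']
    have hp : ∀ s : Control N E, IsProbabilityMeasure
        ((s.law ν).map (Preorder.frestrictLe (π := fun _ : ℕ => Obs N E) n)) := fun s =>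
      Measure.isProbabilityMeasure_map (hr n).aemeasurable
    have := hp s
    have := hp s'
    exact (ih.compProd (ae_of_all _ fun h => step_absolutelyContinuous ν s s' h)).map hφ

/-- Null events of the history are the same for all controls. -/
lemma law_eq_zero_of_law_eq_zero (s s' : Control N E) {A : Set (Path N E)}
    (hA : MeasurableSet[filt N E n] A) (h : s'.law ν A = 0) : s.law ν A = 0 := by
  have hr := Preorder.measurable_frestrictLe (X := fun _ : ℕ => Obs N E) n
  rw [filt_eq] at hA
  obtain ⟨B, hB, rfl⟩ := hA
  rw [← Measure.map_apply hr hB] at h ⊢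
  exact law_map_absolutelyContinuous ν s s' n h

end

section

open Filter Topology

variable {N : ℕ} {E : Type*} [MeasurableSpace E] {n : ℕ} {ω : Path N E}
  (ν : Measure E) [IsProbabilityMeasure ν]

/-! ### Finiteness of the shuttle time -/

lemma measurable_pos_filt {m : ℕ} (h : m ≤ n) :
    Measurable[filt N E n] (pos m : Path N E → ℕ) := by
  have e : (pos m : Path N E → ℕ) = fun ω => pos m (freeze n ω) :=
    funext fun ω => pos_congr (fun i hi => (freeze_apply hi ω).symm) h
  rw [e]
  exact (measurable_pos m).comp (measurable_freeze_filt n)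

/-- The probability of a step from `x` to `z` for ratios `w`. -/
noncomputable def stepProb (N : ℕ) (w : ℕ → ℝ) (x z : ℕ) : ℝ :=
  upProb N w x * (if min (x + 1) N = z then 1 else 0) +
    (1 - upProb N w x) * (if x - 1 = z then 1 else 0)

lemma stepProb_mem (s : Control N E) (ω : Path N E) (x z : ℕ) :
    0 ≤ stepProb N (s.w · ω) x z ∧ stepProb N (s.w · ω) x z ≤ 1 := by
  have := s.upProb_mem ω x
  unfold stepProb
  split_ifs <;> constructor <;> linarith

lemma condExp_step (s : Control N E) (n x z : ℕ) :
    (s.law ν)[{ω : Path N E | pos n ω = x ∧ pos (n + 1) ω = z}.indicator (1 : Path N E → ℝ) |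
      filt N E n] =ᵐ[s.law ν]
      fun ω => if pos n ω = x then stepProb N (s.w · (freeze n ω)) x z else 0 := by
  classical
  have hB : MeasurableSet {ω : Path N E | pos n ω = x ∧ pos (n + 1) ω = z} :=
    (measurableSet_pos n x).inter (measurableSet_pos (n + 1) z)
  have hQ : Measurable fun ω : Path N E => if pos n ω = x then stepProb N (s.w · ω) x z else 0 := by
    refine Measurable.ite (measurableSet_pos n x) ?_ measurable_const
    have hu : Measurable fun ω : Path N E => upProb N (s.w · ω) x := by
      unfold upProb
      split_ifs
      · exact measurable_const
      · exact measurable_const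
      · exact measurable_const.div (measurable_const.add (s.measurable_w x))
    exact (hu.mul_const _).add ((measurable_const.sub hu).mul_const _)
  have hp : ∀ ω : Path N E, pos n (freeze n ω) = pos n ω := fun ω =>
    pos_congr (fun i hi => freeze_apply hi ω) le_rfl
  have hQf : Measurable[filt N E n] fun ω : Path N E =>
      if pos n ω = x then stepProb N (s.w · (freeze n ω)) x z else 0 := by
    have := hQ.comp (measurable_freeze_filt n)
    simp only [Function.comp_def, hp] at this
    exact this
  have hbound : ∀ ω : Path N E,
      ‖if pos n ω = x then stepProb N (s.w · (freeze n ω)) x z else 0‖ ≤ 1 := fun ω => by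
    have := stepProb_mem s (freeze n ω) x z
    rw [Real.norm_eq_abs, abs_le]
    split_ifs <;> constructor <;> linarith
  symm
  refine ae_eq_condExp_of_forall_setIntegral_eq ((filt N E).le n) ?_ ?_ ?_
    hQf.stronglyMeasurable.aestronglyMeasurable
  · exact (integrable_const (1 : ℝ)).indicator hB
  · intro A _ _
    exact (Integrable.of_bound (hQf.mono ((filt N E).le n) le_rfl).aestronglyMeasurable 1
      (ae_of_all _ hbound)).integrableOn
  · intro A hA _
    have h := setIntegral_next ν s (n := n)
      (g := fun y ω => if pos n ω = x then (if (y : ℕ) = z then 1 else 0) else 0) (C := 1)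
      (fun y => Measurable.ite (measurableSet_pos n x) measurable_const measurable_const)
      (fun y ω => by split_ifs <;> simp) hA
    simp only [hp] at h
    convert h.symm using 2
    · funext ω
      have e : ((ω n).2 : ℕ) = pos n ω := rfl
      rw [above_val, below_val, e]
      by_cases h1 : pos n ω = x
      · rw [if_pos h1, if_pos h1, if_pos h1, h1, stepProb]
      · rw [if_neg h1, if_neg h1, if_neg h1]; ring
    · funext ω
      change _ = if pos n ω = x then (if pos (n + 1) ω = z then (1 : ℝ) else 0) else 0
      simp only [Set.indicator, Set.mem_ofPred_eq, Pi.one_apply, ite_and]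

/-- Lévy's extension of the Borel–Cantelli lemma: since the transition probabilities at a level are
frozen, a step that is possible from a level visited infinitely often is taken infinitely often. -/
lemma ae_frequently_of_stepProb_pos (hN : 1 ≤ N) (s : Control N E) {x z : ℕ}
    (h : ∀ ω : Path N E, 0 < stepProb N (s.w · ω) x z) :
    ∀ᵐ ω ∂(s.law ν), (∃ᶠ n in atTop, pos n ω = x) → ∃ᶠ n in atTop, pos n ω = z := by
  classical
  -- the event that the step into time `n` leads from `x` to `z`
  let B : ℕ → Set (Path N E) := fun n =>
    if n = 0 then ∅ else {ω | pos (n - 1) ω = x ∧ pos n ω = z}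
  have hB : ∀ n, MeasurableSet[filt N E n] (B n) := by
    intro n
    by_cases hn : n = 0
    · simp only [B, hn, if_true]; exact @MeasurableSet.empty _ (filt N E _)
    · simp only [B, hn, if_false]
      exact @MeasurableSet.inter _ (filt N E n) _ _
        (measurable_pos_filt (Nat.sub_le n 1) (measurableSet_singleton x))
        (measurable_pos_filt le_rfl (measurableSet_singleton z))
  filter_upwards [ae_mem_limsup_atTop_iff (s.law ν) hB, ae_isWalk ν hN s,
    ae_all_iff.2 fun n => condExp_step ν s n x z] with ω hω hwalk hce hx
  have hterm : ∀ k, ((s.law ν)[(B (k + 1)).indicator (1 : Path N E → ℝ) | filt N E k]) ω =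
      {n : ℕ | pos n ω = x}.indicator (fun _ => stepProb N (s.w · ω) x z) k := by
    intro k
    refine (hce k).trans ?_
    by_cases hk : pos k ω = x
    · rw [if_pos hk, Set.indicator_of_mem (by exact hk)]
      have hw : s.w x (freeze k ω) = s.w x ω :=
        (s.w_congr (n := k) (fun i hi => (freeze_apply hi ω).symm) ⟨k, le_rfl, hk⟩).symm
      simp only [stepProb, upProb, hw]
    · rw [if_neg hk, Set.indicator_of_notMem (by exact hk)]
  simp only [hterm] at hω
  have hdiv : ω ∈ limsup (fun n => {ω : Path N E | pos n ω = x}) atTop := by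
    rw [mem_limsup_iff_frequently_mem]; exact hx
  rw [Set.limsup_eq_tendsto_sum_indicator_atTop (h ω)] at hdiv
  have hlim := hω.2 (by
    refine (Tendsto.congr fun n => ?_) hdiv
    refine Finset.sum_congr rfl fun k _ => ?_
    simp only [Set.indicator, Set.mem_ofPred_eq])
  rw [mem_limsup_iff_frequently_mem] at hlim
  refine hlim.mono fun n hn => ?_
  by_cases h0 : n = 0
  · simp [B, h0] at hn
  · simp only [B, h0, if_false] at hn
    exact hn.2

lemma ae_frequently_succ (hN : 1 ≤ N) (s : Control N E) {x : ℕ} (hx : x < N) :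
    ∀ᵐ ω ∂(s.law ν), (∃ᶠ n in atTop, pos n ω = x) → ∃ᶠ n in atTop, pos n ω = x + 1 := by
  refine ae_frequently_of_stepProb_pos ν hN s fun ω => ?_
  have h1 := s.upProb_mem ω x
  have h2 : upProb N (s.w · ω) x ≠ 0 := by
    rw [Ne, upProb_eq_zero_iff fun x => s.pos_w x ω]; omega
  have h3 := h1.1.lt_of_ne' h2
  rw [stepProb, if_pos (min_eq_left hx), if_neg (by omega)]
  linarith

lemma ae_frequently_pred (hN : 1 ≤ N) (s : Control N E) (x : ℕ) :
    ∀ᵐ ω ∂(s.law ν), (∃ᶠ n in atTop, pos n ω = x + 1) → ∃ᶠ n in atTop, pos n ω = x := by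
  refine ae_frequently_of_stepProb_pos ν hN s fun ω => ?_
  have h1 := s.upProb_mem ω (x + 1)
  have h2 : 1 - upProb N (s.w · ω) (x + 1) ≠ 0 := by
    rw [Ne, one_sub_upProb_eq_zero_iff fun x => s.pos_w x ω]; omega
  have h3 := (sub_nonneg.2 h1.2).lt_of_ne' h2
  rw [stepProb, Nat.add_sub_cancel, if_pos rfl]
  split_ifs <;> linarith

/-- The levels visited infinitely often contain, with one level, all the others: so both ends are
visited infinitely often. -/
lemma ae_exists_shuttled (hN : 1 ≤ N) (s : Control N E) :
    ∀ᵐ ω ∂(s.law ν), ∃ n, Shuttled n ω := by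
  have hup : ∀ᵐ ω ∂(s.law ν), ∀ x < N,
      (∃ᶠ n in atTop, pos n ω = x) → ∃ᶠ n in atTop, pos n ω = x + 1 :=
    ae_all_iff.2 fun x => by
      by_cases hx : x < N
      · filter_upwards [ae_frequently_succ ν hN s hx] with ω h _ using h
      · exact ae_of_all _ fun ω h => absurd h hx
  filter_upwards [hup, ae_all_iff.2 fun x => ae_frequently_pred ν hN s x] with ω hu hd
  obtain ⟨x, hxN, hx⟩ : ∃ x ≤ N, ∃ᶠ n in atTop, pos n ω = x := by
    by_contra! hcon
    have hall : ∀ᶠ n in atTop, ∀ x ∈ Finset.range (N + 1), pos n ω ≠ x :=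
      (Filter.eventually_all_finset _).2 fun x hx =>
        hcon x (Nat.lt_succ_iff.1 (Finset.mem_range.1 hx))
    obtain ⟨n, hn⟩ := hall.exists
    exact hn (pos n ω) (Finset.mem_range.2 (Nat.lt_succ_of_le (pos_le n ω))) rfl
  have hNio : ∀ y, x ≤ y → y ≤ N → ∃ᶠ n in atTop, pos n ω = y := by
    intro y hy
    induction y, hy using Nat.le_induction with
    | base => exact fun _ => hx
    | succ m hm ih => exact fun hmN => hu m hmN (ih (by omega))
  have h0io : ∀ y, (∃ᶠ n in atTop, pos n ω = y) → ∃ᶠ n in atTop, pos n ω = 0 := by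
    intro y
    induction y with
    | zero => exact id
    | succ m ih => exact fun h => ih (hd m h)
  have hNi := hNio N hxN le_rfl
  obtain ⟨m, hm⟩ := hNi.exists
  obtain ⟨j, hj, hj0⟩ := (frequently_atTop.1 (h0io N hNi)) (m + 1)
  exact ⟨j, j, le_rfl, hj0, m, hj, hm⟩

/-! ### Martingale estimates -/

variable {r : ℕ → ℝ}

lemma wsol_mem (hr : ∀ x ≤ N, 0 ≤ r x ∧ r x ≤ 1) (s : Control N E) {c : ℝ} (hc : 0 ≤ c)
    (hc1 : c ≤ 1) (n : ℕ) (ω : Path N E) : 0 ≤ wsol r s c n ω ∧ wsol r s c n ω ≤ 1 := by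
  have h := solution_mem hr s n ω
  have h1 := pow_nonneg hc (N - runMax n ω)
  have h2 := pow_le_one₀ hc hc1 (n := N - runMax n ω)
  exact ⟨mul_nonneg h1 h.1, mul_le_one₀ h2 h.1 h.2⟩

lemma wsol_one (r : ℕ → ℝ) (s : Control N E) (n : ℕ) (ω : Path N E) :
    wsol r s 1 n ω = solution r s n ω := by rw [wsol, one_pow, one_mul]

lemma integrable_of_mem_unitInterval {μ : Measure (Path N E)} [IsFiniteMeasure μ]
    {f : Path N E → ℝ} (hf : Measurable f) (h : ∀ ω, 0 ≤ f ω ∧ f ω ≤ 1) : Integrable f μ :=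
  Integrable.of_bound hf.aestronglyMeasurable 1 (ae_of_all _ fun ω => by
    rw [Real.norm_eq_abs, abs_le]; exact ⟨by linarith [(h ω).1], (h ω).2⟩)

lemma measurable_stepMean (s : Control N E) (c : ℝ) (n : ℕ) : Measurable (stepMean r s c n) := by
  have hx := measurable_pos (N := N) (E := E) n
  exact ((s.measurable_upProb n).mul (measurable_apply_nat (measurable_stepVal r s c n)
      ((measurable_of_countable fun x : ℕ => min (x + 1) N).comp hx))).add
    ((measurable_const.sub (s.measurable_upProb n)).mul (measurable_apply_nat
      (measurable_stepVal r s c n) ((measurable_of_countable fun x : ℕ => x - 1).comp hx)))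

lemma stepMean_mem (hr : ∀ x ≤ N, 0 ≤ r x ∧ r x ≤ 1) (s : Control N E) {c : ℝ} (hc : 0 ≤ c)
    (hc1 : c ≤ 1) (n : ℕ) (ω : Path N E) : 0 ≤ stepMean r s c n ω ∧ stepMean r s c n ω ≤ 1 := by
  have h1 := stepVal_mem hr s hc hc1 n ω (min_le_right (pos n ω + 1) N)
  have h2 := stepVal_mem hr s hc hc1 n ω (x := pos n ω - 1) (by have := pos_le n ω; omega)
  have h3 := s.upProb_mem ω (pos n ω)
  unfold stepMean
  constructor <;> nlinarith

lemma stepMean_congr {ω' : Path N E} (s : Control N E) (c : ℝ) (h : ∀ i ≤ n, ω i = ω' i)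
    (hω : IsWalk n ω) : stepMean r s c n ω = stepMean r s c n ω' := by
  have hw : s.w (pos n ω) ω = s.w (pos n ω) ω' := s.w_congr h ⟨n, le_rfl, rfl⟩
  have hx := pos_le_runMax le_rfl ω (n := n)
  unfold stepMean upProb
  simp only [← pos_congr h le_rfl, hw]
  rw [stepVal_congr s c h hω (by omega), stepVal_congr s c h hω (by omega)]

/-- `stepMean` is the conditional mean of `wsol` at the next time. -/
lemma setIntegral_wsol_succ (hN : 1 ≤ N) (hr : ∀ x ≤ N, 0 ≤ r x ∧ r x ≤ 1) (s : Control N E)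
    {c : ℝ} (hc : 0 ≤ c) (hc1 : c ≤ 1) {A : Set (Path N E)} (hA : MeasurableSet[filt N E n] A) :
    ∫ ω in A, wsol r s c (n + 1) ω ∂(s.law ν) = ∫ ω in A, stepMean r s c n ω ∂(s.law ν) := by
  have hA' := (filt N E).le n A hA
  have h := setIntegral_next ν s (g := fun y ω => stepVal r s c n ω y) (C := 1)
    (fun y => measurable_stepVal r s c n y) (fun y ω => by
      have := stepVal_mem hr s hc hc1 n ω (x := y) (Nat.lt_succ_iff.1 y.2)
      rw [abs_le]; exact ⟨by linarith [this.1], this.2⟩) hA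
  refine Eq.trans ?_ (h.trans ?_)
  · refine setIntegral_congr_ae hA' ?_
    filter_upwards [ae_isWalk ν hN s] with ω hω _
    have hx : pos (n + 1) ω ≤ runMax n ω + 1 := by
      have h1 := pos_le_runMax le_rfl ω (n := n)
      have h2 := (hω (n + 1)).2 n n.lt_succ_self
      omega
    rw [wsol_succ hr]
    exact stepVal_congr s c (fun i hi => (freeze_apply hi ω).symm) (hω n) hx
  · refine setIntegral_congr_ae hA' ?_
    filter_upwards [ae_isWalk ν hN s] with ω hω _
    rw [stepMean_congr s c (fun i hi => (freeze_apply hi ω).symm) (hω n), stepMean,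
      pos_congr (fun i hi => freeze_apply hi ω) le_rfl]
    rfl

/-- After the shuttle time all factors of `wsol` but the discount are `1`. -/
lemma tendsto_setIntegral_wsol (hN : 1 ≤ N) (hr : ∀ x ≤ N, 0 ≤ r x ∧ r x ≤ 1)
    (s : Control N E) {c : ℝ} (hc : 0 ≤ c) (hc1 : c ≤ 1) (A : Set (Path N E)) :
    Tendsto (fun n => ∫ ω in A, wsol r s c n ω ∂(s.law ν)) atTop
      (𝓝 (∫ ω in A, payoff r ω ∂(s.law ν))) := by
  refine tendsto_integral_of_dominated_convergence (fun _ => 1)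
    (fun n => (measurable_wsol hr s c n).aestronglyMeasurable) (integrable_const _)
    (fun n => ae_of_all _ fun ω => ?_) (ae_restrict_of_ae ?_)
  · have := wsol_mem hr s hc hc1 n ω
    rw [Real.norm_eq_abs, abs_le]; exact ⟨by linarith [this.1], this.2⟩
  · filter_upwards [ae_exists_shuttled ν hN s] with ω hω
    obtain ⟨m, hm⟩ := hω
    refine tendsto_const_nhds.congr' ?_
    filter_upwards [eventually_ge_atTop m] with n hn
    have hS := hm.mono hn
    rw [wsol, hS.runMax_eq, Nat.sub_self, pow_zero, one_mul, solution_of_shuttled hr s hS,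
      payoff_eq hr hS]

/-- The supermartingale bound, valid for every control. -/
lemma setIntegral_payoff_le (hN : 1 ≤ N) (hr : ∀ x ≤ N, 0 ≤ r x ∧ r x ≤ 1) (s : Control N E)
    {A : Set (Path N E)} (hA : MeasurableSet[filt N E n] A) :
    ∫ ω in A, payoff r ω ∂(s.law ν) ≤ ∫ ω in A, solution r s n ω ∂(s.law ν) := by
  have hanti : ∀ m, n ≤ m → ∫ ω in A, wsol r s 1 m ω ∂(s.law ν) ≤
      ∫ ω in A, wsol r s 1 n ω ∂(s.law ν) := by
    intro m hm
    induction m, hm using Nat.le_induction with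
    | base => rfl
    | succ m hm ih =>
      refine le_trans ?_ ih
      rw [setIntegral_wsol_succ ν hN hr s zero_le_one le_rfl ((filt N E).mono hm A hA)]
      exact integral_mono
        (integrable_of_mem_unitInterval (measurable_stepMean s 1 m)
          (stepMean_mem hr s zero_le_one le_rfl m))
        (integrable_of_mem_unitInterval (measurable_wsol hr s 1 m)
          (wsol_mem hr s zero_le_one le_rfl m)) (stepMean_le hN hr s m)
  have h := le_of_tendsto (tendsto_setIntegral_wsol ν hN hr s zero_le_one le_rfl A)
    (eventually_atTop.2 ⟨n, hanti⟩)
  simpa only [wsol_one] using h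

/-- The submartingale bound, for controls under which `ψ̂` loses at most a factor `c` per level. -/
lemma setIntegral_wsol_le_payoff (hN : 1 ≤ N) (hr : ∀ x ≤ N, 0 ≤ r x ∧ r x ≤ 1)
    (s : Control N E) {c : ℝ} (hc : 0 ≤ c) (hc1 : c ≤ 1) {A : Set (Path N E)}
    (hA : MeasurableSet[filt N E n] A)
    (hψ : ∀ᵐ ω ∂(s.law ν), ω ∈ A → ∀ m, n ≤ m → runMax m ω < N →
      c * psiHat N r (s.W ω) (runMax m ω) ≤ psiHat N r (s.W ω) (runMax m ω + 1)) :
    ∫ ω in A, wsol r s c n ω ∂(s.law ν) ≤ ∫ ω in A, payoff r ω ∂(s.law ν) := by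
  have hmono : ∀ m, n ≤ m → ∫ ω in A, wsol r s c n ω ∂(s.law ν) ≤
      ∫ ω in A, wsol r s c m ω ∂(s.law ν) := by
    intro m hm
    induction m, hm using Nat.le_induction with
    | base => rfl
    | succ m hm ih =>
      refine ih.trans ?_
      rw [setIntegral_wsol_succ ν hN hr s hc hc1 ((filt N E).mono hm A hA)]
      refine setIntegral_mono_on_ae
        (integrable_of_mem_unitInterval (measurable_wsol hr s c m) (wsol_mem hr s hc hc1 m))
        (integrable_of_mem_unitInterval (measurable_stepMean s c m)
          (stepMean_mem hr s hc hc1 m)) ((filt N E).le n A hA) ?_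
      filter_upwards [hψ] with ω hω hωA
      exact le_stepMean hN hr s hc (hω hωA m hm)
  exact ge_of_tendsto (tendsto_setIntegral_wsol ν hN hr s hc hc1 A)
    (eventually_atTop.2 ⟨n, hmono⟩)

end

/-! ### Nearly optimal controls -/

/-- Stage `m` of the recursion that replaces the entries `y ≤ k < m` of `u` by nearly optimal ones.
The entry `0` is never changed, and neither are those from `N` on, which no chain uses. -/
noncomputable def nearOptStage (N : ℕ) (r : ℕ → ℝ) (y : ℕ) (η : ℝ) (u : ℕ → ℝ) : ℕ → ℕ → ℝ
  | 0 => u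
  | m + 1 => fun j =>
      if j = m ∧ y ≤ m ∧ m ≠ 0 ∧ m < N then
        nearMin η
          (tau r m * calG N r (nearOptStage N r y η u m) m *
            deltaTildeGStar N r (nearOptStage N r y η u m) m)
          (deltaG N r (nearOptStage N r y η u m) m * tildeGStar N r (nearOptStage N r y η u m) m)
      else nearOptStage N r y η u m j

/-- The scale increments that agree with `u` below `y` and are nearly optimal from `y` on. -/
noncomputable def nearOpt (N : ℕ) (r : ℕ → ℝ) (y : ℕ) (η : ℝ) (u : ℕ → ℝ) (k : ℕ) : ℝ :=
  nearOptStage N r y η u (k + 1) k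

section NearOpt

variable {N : ℕ} {r : ℕ → ℝ} {y : ℕ} {η : ℝ} {u : ℕ → ℝ}

lemma nearOptStage_succ (m j : ℕ) : nearOptStage N r y η u (m + 1) j =
    if j = m ∧ y ≤ m ∧ m ≠ 0 ∧ m < N then
      nearMin η
        (tau r m * calG N r (nearOptStage N r y η u m) m *
          deltaTildeGStar N r (nearOptStage N r y η u m) m)
        (deltaG N r (nearOptStage N r y η u m) m * tildeGStar N r (nearOptStage N r y η u m) m)
    else nearOptStage N r y η u m j := rfl

lemma nearOptStage_of_lt {m j : ℕ} (h : j < m) :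
    nearOptStage N r y η u m j = nearOpt N r y η u j := by
  induction m, h using Nat.le_induction with
  | base => rfl
  | succ m hm ih => rw [nearOptStage_succ, if_neg (by omega), ih]

lemma nearOptStage_of_le {m j : ℕ} (h : m ≤ j) : nearOptStage N r y η u m j = u j := by
  induction m with
  | zero => rfl
  | succ m ih => rw [nearOptStage_succ, if_neg (by omega), ih (by omega)]

lemma nearOpt_of_not {k : ℕ} (h : ¬ (y ≤ k ∧ k ≠ 0 ∧ k < N)) : nearOpt N r y η u k = u k := by
  rw [nearOpt, nearOptStage_succ, if_neg (by tauto), nearOptStage_of_le le_rfl]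

lemma nearOpt_eq_nearMin {k : ℕ} (h : y ≤ k) (h0 : k ≠ 0) (hk : k < N) :
    nearOpt N r y η u k = nearMin η
      (tau r k * calG N r (nearOpt N r y η u) k * deltaTildeGStar N r (nearOpt N r y η u) k)
      (deltaG N r (nearOpt N r y η u) k * tildeGStar N r (nearOpt N r y η u) k) := by
  have hc : ∀ j < k, nearOptStage N r y η u k j = nearOpt N r y η u j := fun j hj =>
    nearOptStage_of_lt hj
  rw [nearOpt, nearOptStage_succ, if_pos ⟨rfl, h, h0, hk⟩, calG_congr hc, deltaTildeGStar_congr hc,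
    deltaG_congr hc, tildeGStar_congr hc]

lemma nearOptStage_pos (hr : ∀ x ≤ N, 0 ≤ r x ∧ r x ≤ 1) (hη : 0 < η) (hu : ∀ k, 0 < u k)
    (m j : ℕ) : 0 < nearOptStage N r y η u m j := by
  induction m generalizing j with
  | zero => exact hu j
  | succ m ih =>
    rw [nearOptStage_succ]
    split_ifs with h
    · have hm := h.2.2.2
      exact nearMin_pos hη
        (mul_nonneg (mul_nonneg (tau_nonneg hr hm) (zero_le_one.trans (one_le_calG hr ih hm.le)))
          (deltaTildeGStar_nonneg hr ih hm.le))
        (mul_nonneg (deltaG_nonneg hr ih hm.le) (zero_le_one.trans (one_le_tildeGStar hr ih hm.le)))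
    · exact ih j

lemma nearOpt_pos (hr : ∀ x ≤ N, 0 ≤ r x ∧ r x ≤ 1) (hη : 0 < η) (hu : ∀ k, 0 < u k) (k : ℕ) :
    0 < nearOpt N r y η u k := nearOptStage_pos hr hη hu _ _

lemma nearOpt_congr {u' : ℕ → ℝ} {k : ℕ} (h : ∀ j ≤ k, u j = u' j) :
    nearOpt N r y η u k = nearOpt N r y η u' k := by
  induction k using Nat.strong_induction_on with
  | _ k ih =>
    by_cases hk : y ≤ k ∧ k ≠ 0 ∧ k < N
    · have hc : ∀ j < k, nearOpt N r y η u j = nearOpt N r y η u' j := fun j hj =>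
        ih j hj fun i hi => h i (hi.trans hj.le)
      rw [nearOpt_eq_nearMin hk.1 hk.2.1 hk.2.2, nearOpt_eq_nearMin hk.1 hk.2.1 hk.2.2,
        calG_congr hc, deltaTildeGStar_congr hc, deltaG_congr hc, tildeGStar_congr hc]
    · rw [nearOpt_of_not hk, nearOpt_of_not hk, h k le_rfl]

lemma measurable_nearOpt {Ω : Type*} [MeasurableSpace Ω] {u : Ω → ℕ → ℝ}
    (hu : ∀ k, Measurable fun ω => u ω k) (k : ℕ) :
    Measurable fun ω => nearOpt N r y η (u ω) k := by
  suffices h : ∀ m j, Measurable fun ω => nearOptStage N r y η (u ω) m j from h _ _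
  intro m
  induction m with
  | zero => exact hu
  | succ m ih =>
    intro j
    simp only [nearOptStage_succ]
    split_ifs
    · have ha := ((measurable_calG (N := N) ih r m).const_mul (tau r m)).mul
        (measurable_deltaTildeGStar (N := N) ih r m)
      have hb := (measurable_deltaG (N := N) ih r m).mul (measurable_tildeGStar (N := N) ih r m)
      have hε := measurable_const (a := η).div ((measurable_const (a := (1 : ℝ)).add ha).add hb)
      exact ((ha.add hε).div (hb.add hε)).sqrt
    · exact ih j

/-- The factor by which `rootPsi` may grow from one level to the next under a nearly optimal
control. -/
noncomputable def growth (N : ℕ) (r : ℕ → ℝ) (η : ℝ) : ℝ :=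
  1 + √η + √(2 * √η) * ∑ k ∈ Finset.range (N + 1), oddA N r k

lemma one_le_growth (N : ℕ) (r : ℕ → ℝ) (η : ℝ) : 1 ≤ growth N r η := by
  have h1 := Real.sqrt_nonneg η
  have h2 := mul_nonneg (Real.sqrt_nonneg (2 * √η))
    (Finset.sum_nonneg fun k (_ : k ∈ Finset.range (N + 1)) => oddA_nonneg N r k)
  unfold growth; linarith

lemma rootPsi_nearOpt_succ_le (hr : ∀ x ≤ N, 0 ≤ r x ∧ r x ≤ 1) (hη : 0 < η) (hη1 : η ≤ 1)
    (hu : ∀ k, 0 < u k) (hu0 : u 0 = 1) {k : ℕ} (hyk : y ≤ k) (hk : k < N) :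
    rootPsi N r (nearOpt N r y η u) (k + 1) ≤
      growth N r η * rootPsi N r (nearOpt N r y η u) k := by
  have hW := nearOpt_pos (y := y) hr hη hu
  by_cases h0 : k = 0
  · subst h0
    rw [rootPsi_one hk (by rw [nearOpt_of_not (by tauto), hu0])]
    have := one_le_rootPsi hr hW hk.le
    exact le_mul_of_one_le_left (by linarith) (one_le_growth N r η)
  · refine rootPsi_succ_le hr hW hη hη1 ?_ hk (nearOpt_eq_nearMin hyk h0 hk)
    exact Finset.single_le_sum (f := fun k => oddA N r k) (fun k _ => oddA_nonneg N r k)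
      (Finset.mem_range.2 (by omega))

lemma psiHat_nearOpt_le (hr : ∀ x ≤ N, 0 ≤ r x ∧ r x ≤ 1) (hη : 0 < η) (hη1 : η ≤ 1)
    (hu : ∀ k, 0 < u k) (hu0 : u 0 = 1) {k : ℕ} (hyk : y ≤ k) (hk : k < N) :
    (growth N r η ^ 2)⁻¹ * psiHat N r (nearOpt N r y η u) k ≤
      psiHat N r (nearOpt N r y η u) (k + 1) := by
  have hW := nearOpt_pos (y := y) hr hη hu
  have h := rootPsi_nearOpt_succ_le hr hη hη1 hu hu0 hyk hk
  have h1 := one_le_rootPsi hr hW (y := k + 1) hk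
  rw [psiHat_eq, psiHat_eq, ← mul_inv, ← mul_pow]
  exact inv_anti₀ (by positivity) (pow_le_pow_left₀ (by positivity) h 2)

end NearOpt

section Control

variable {N : ℕ} {E : Type*} [MeasurableSpace E] {n : ℕ} {ω : Path N E} {r : ℕ → ℝ} {y : ℕ}
  {η : ℝ}

/-- The time of the first visit to `x`, `0` if there is none. -/
noncomputable def visitTime (x : ℕ) (ω : Path N E) : ℕ := sInf {n | pos n ω = x}

omit [MeasurableSpace E] in
lemma visitTime_of_mem {x : ℕ} (h : ω ∈ firstVisit x n) : visitTime x ω = n :=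
  le_antisymm (Nat.sInf_le h.1) (le_csInf ⟨n, h.1⟩ fun m hm => by
    by_contra hlt
    exact h.2 m (not_le.1 hlt) hm)

omit [MeasurableSpace E] in
lemma mem_firstVisit_visitTime {x m : ℕ} (h : pos m ω = x) :
    ω ∈ firstVisit x (visitTime x ω) ∧ visitTime x ω ≤ m :=
  ⟨⟨Nat.sInf_mem (s := {n | pos n ω = x}) ⟨m, h⟩, fun _ hk =>
    Nat.notMem_of_lt_sInf (s := {n | pos n ω = x}) hk⟩,
    Nat.sInf_le h⟩

lemma measurableSet_firstVisit_filt (x n : ℕ) :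
    MeasurableSet[filt N E n] (firstVisit x n : Set (Path N E)) := by
  have h : (firstVisit x n : Set (Path N E)) =
      pos n ⁻¹' {x} ∩ ⋂ m ∈ Set.Iio n, (pos m ⁻¹' {x})ᶜ := by
    ext ω; simp [firstVisit]
  rw [h]
  refine @MeasurableSet.inter _ (filt N E n) _ _
    (measurable_pos_filt le_rfl (measurableSet_singleton x))
    (@MeasurableSet.biInter _ _ (filt N E n) _ _ (Set.to_countable _) fun m hm => ?_)
  exact @MeasurableSet.compl _ _ (filt N E n)
    (measurable_pos_filt (le_of_lt hm) (measurableSet_singleton x))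

lemma measurable_visitTime (x : ℕ) : Measurable (visitTime x : Path N E → ℕ) := by
  have hF : ∀ n, MeasurableSet (firstVisit x n : Set (Path N E)) := fun n =>
    (filt N E).le n _ (measurableSet_firstVisit_filt x n)
  refine measurable_to_countable' fun n => ?_
  have h : (visitTime x : Path N E → ℕ) ⁻¹' {n} =
      firstVisit x n ∪ if n = 0 then (⋃ m, firstVisit x m)ᶜ else ∅ := by
    ext ω
    simp only [Set.mem_preimage, Set.mem_singleton_iff, Set.mem_union]
    by_cases hv : ∃ m, pos m ω = x
    · obtain ⟨m, hm⟩ := hv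
      have hmem := (mem_firstVisit_visitTime hm).1
      constructor
      · rintro rfl; exact Or.inl hmem
      · rintro (h | h)
        · exact visitTime_of_mem h
        · split_ifs at h
          · exact absurd (Set.mem_iUnion.2 ⟨_, hmem⟩) h
          · exact absurd h (Set.notMem_empty _)
    · have hempty : {n | pos n ω = x} = ∅ := Set.eq_empty_of_forall_notMem fun m hm => hv ⟨m, hm⟩
      have h0 : visitTime x ω = 0 := by rw [visitTime, hempty, Nat.sInf_empty]
      have hnot : ∀ m, ω ∉ firstVisit x m := fun m hm => hv ⟨m, hm.1⟩
      rw [h0]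
      constructor
      · rintro rfl
        right
        rw [if_pos rfl]
        simpa using hnot
      · rintro (h | h)
        · exact absurd h (hnot n)
        · split_ifs at h with hn
          · exact hn.symm
          · exact absurd h (Set.notMem_empty _)
  rw [h]
  refine (hF n).union ?_
  split_ifs
  · exact (MeasurableSet.iUnion hF).compl
  · exact MeasurableSet.empty

/-- The control that follows `s` at the levels below `y` and chooses nearly optimal scale
increments from level `y` on. Freezing the path at the first visit makes the choice depend on the
information available then, on arbitrary trajectories. -/
noncomputable def nearOptControl (hr : ∀ x ≤ N, 0 ≤ r x ∧ r x ≤ 1) (hη : 0 < η) (s : Control N E)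
    (y : ℕ) : Control N E where
  w x ω := if x < y then s.w x ω else
    nearOpt N r y η (s.W (freeze (visitTime x ω) ω)) x /
      nearOpt N r y η (s.W (freeze (visitTime x ω) ω)) (x - 1)
  pos_w x ω := by
    split_ifs
    · exact s.pos_w x ω
    · exact div_pos (nearOpt_pos hr hη (s.W_pos _) _) (nearOpt_pos hr hη (s.W_pos _) _)
  measurable_w x := by
    by_cases hx : x < y
    · simp only [hx, if_true]; exact s.measurable_w x
    · simp only [hx, if_false]
      exact measurable_apply_nat (f := fun n ω => nearOpt N r y η (s.W (freeze n ω)) x /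
        nearOpt N r y η (s.W (freeze n ω)) (x - 1)) (fun n =>
          ((measurable_nearOpt s.measurable_W x).comp (measurable_freeze n)).div
            ((measurable_nearOpt s.measurable_W (x - 1)).comp (measurable_freeze n)))
        (measurable_visitTime x)
  adapted_w x n := by
    by_cases hx : x < y
    · simp only [hx, if_true]; exact s.adapted_w x n
    · simp only [hx, if_false]
      have e : (firstVisit x n).indicator (fun ω : Path N E =>
          nearOpt N r y η (s.W (freeze (visitTime x ω) ω)) x /
            nearOpt N r y η (s.W (freeze (visitTime x ω) ω)) (x - 1)) =
          (firstVisit x n).indicator fun ω : Path N E =>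
            nearOpt N r y η (s.W (freeze n ω)) x / nearOpt N r y η (s.W (freeze n ω)) (x - 1) :=
        Set.indicator_congr fun ω hω => by rw [visitTime_of_mem hω]
      rw [e]
      have hm : Measurable fun ω : Path N E =>
          nearOpt N r y η (s.W ω) x / nearOpt N r y η (s.W ω) (x - 1) :=
        (measurable_nearOpt s.measurable_W x).div (measurable_nearOpt s.measurable_W (x - 1))
      exact (hm.comp (measurable_freeze_filt n)).indicator (measurableSet_firstVisit_filt x n)

variable (hr : ∀ x ≤ N, 0 ≤ r x ∧ r x ≤ 1) (hη : 0 < η) (s : Control N E)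

lemma nearOptControl_mem_constrained (y : ℕ) : nearOptControl hr hη s y ∈ constrained s y := by
  intro k hk ω
  refine Finset.prod_congr rfl fun j hj => ?_
  exact if_pos ((Finset.mem_Icc.1 hj).2.trans_lt hk)

/-- On nearest neighbour paths the control has the intended scale increments at the visited
levels. -/
lemma nearOptControl_W (hω : IsWalk n ω) {k : ℕ} (hk : k ≤ runMax n ω) :
    (nearOptControl hr hη s y).W ω k = nearOpt N r y η (s.W ω) k := by
  induction k with
  | zero => rw [Control.W_zero, nearOpt_of_not (by tauto), Control.W_zero]
  | succ k ih =>
    rw [Control.W_succ, ih (by omega)]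
    change nearOpt N r y η (s.W ω) k * (if k + 1 < y then s.w (k + 1) ω else _) = _
    split_ifs with h
    · rw [nearOpt_of_not (by omega), nearOpt_of_not (by omega), Control.W_succ]
    · obtain ⟨m, hm, hpos⟩ := hω.exists_pos_eq hk
      obtain ⟨hT, hTm⟩ := mem_firstVisit_visitTime hpos
      have hWT : ∀ j ≤ k + 1, s.W (freeze (visitTime (k + 1) ω) ω) j = s.W ω j := fun j hj =>
        (s.W_congr (n := visitTime (k + 1) ω) (fun i hi => (freeze_apply hi ω).symm)
          (hω.mono (hTm.trans hm))
          (hj.trans (hT.1.symm.le.trans (pos_le_runMax le_rfl ω)))).symm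
      rw [nearOpt_congr hWT, Nat.add_sub_cancel, nearOpt_congr fun j hj => hWT j (by omega)]
      have := nearOpt_pos (y := y) hr hη (s.W_pos ω) k
      field_simp

lemma nearOptControl_psiHat_le (hη1 : η ≤ 1) (hω : IsWalk n ω) (hy : y ≤ runMax n ω)
    (hM : runMax n ω < N) :
    (growth N r η ^ 2)⁻¹ * psiHat N r ((nearOptControl hr hη s y).W ω) (runMax n ω) ≤
      psiHat N r ((nearOptControl hr hη s y).W ω) (runMax n ω + 1) := by
  have h := fun k (hk : k ≤ runMax n ω) => nearOptControl_W (y := y) hr hη s hω hk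
  rw [psiHat_congr fun k hk => h k hk.le,
    psiHat_congr (y := runMax n ω + 1) fun k hk => h k (Nat.lt_succ_iff.1 hk)]
  exact psiHat_nearOpt_le hr hη hη1 (s.W_pos ω) (s.W_zero ω) hy hM

end Control

section

open Filter Topology

variable {N : ℕ} {E : Type*} [MeasurableSpace E] {t y : ℕ} {r : ℕ → ℝ}
  (ν : Measure E) [IsProbabilityMeasure ν]

/-! ### The essential supremum -/

/-- An inequality between the integrals over all events of a sub-σ-algebra inside `B` gives an
almost sure inequality on `B`. -/
lemma ae_le_on_of_setIntegral_le {Ω : Type*} {m m₀ : MeasurableSpace Ω} {μ : Measure[m₀] Ω}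
    (hm : m ≤ m₀) {f g : Ω → ℝ} (hf : Measurable[m] f) (hg : Measurable[m] g)
    (hfi : Integrable f μ) (hgi : Integrable g μ) {B : Set Ω} (hB : MeasurableSet[m] B)
    (h : ∀ A ⊆ B, MeasurableSet[m] A → ∫ ω in A, f ω ∂μ ≤ ∫ ω in A, g ω ∂μ) :
    ∀ᵐ ω ∂μ, ω ∈ B → f ω ≤ g ω := by
  set A : Set Ω := B ∩ {ω | g ω < f ω} with hA
  have hAm : MeasurableSet[m] A := hB.inter (@measurableSet_lt _ _ _ _ _ m _ _ _ _ _ hg hf)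
  have hAm₀ := hm A hAm
  have h1 := h A Set.inter_subset_left hAm
  have h2 : 0 ≤ᵐ[μ.restrict A] fun ω => f ω - g ω :=
    (ae_restrict_iff' hAm₀).2 (ae_of_all _ fun ω hω => sub_nonneg.2 (le_of_lt hω.2))
  have h3 : ∫ ω in A, (f ω - g ω) ∂μ = 0 :=
    le_antisymm (by rw [integral_sub hfi.integrableOn hgi.integrableOn]; linarith)
      (integral_nonneg_of_ae h2)
  rw [integral_eq_zero_iff_of_nonneg_ae h2 (hfi.sub hgi).integrableOn] at h3
  filter_upwards [(ae_restrict_iff' hAm₀).1 h3] with ω hω hωB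
  by_contra hlt
  have := hω ⟨hωB, not_le.1 hlt⟩
  simp only [Pi.zero_apply] at this
  linarith [not_le.1 hlt]

/-- Almost sure inequalities between functions of the history carry over from one control to
another. -/
lemma ae_le_on_of_control (s s₀ : Control N E) {f g : Path N E → ℝ}
    (hf : Measurable[filt N E t] f) (hg : Measurable[filt N E t] g) {B : Set (Path N E)}
    (hB : MeasurableSet[filt N E t] B) (h : ∀ᵐ ω ∂(s.law ν), ω ∈ B → f ω ≤ g ω) :
    ∀ᵐ ω ∂(s₀.law ν), ω ∈ B → f ω ≤ g ω := by
  have hA : MeasurableSet[filt N E t] (B ∩ {ω | g ω < f ω}) :=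
    hB.inter (@measurableSet_lt _ _ _ _ _ (filt N E t) _ _ _ _ _ hg hf)
  have e : {ω : Path N E | ω ∈ B → f ω ≤ g ω}ᶜ = B ∩ {ω | g ω < f ω} := by
    ext ω; simp
  have h' : s.law ν ({ω : Path N E | ω ∈ B → f ω ≤ g ω}ᶜ) = 0 := h
  change s₀.law ν ({ω : Path N E | ω ∈ B → f ω ≤ g ω}ᶜ) = 0
  rw [e] at h' ⊢
  exact law_eq_zero_of_law_eq_zero ν s₀ s hA h'

lemma measurableSet_runMax_filt (t y : ℕ) :
    MeasurableSet[filt N E t] {ω : Path N E | runMax t ω = y} := by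
  have h : {ω : Path N E | runMax t ω = y} = (fun ω => runMax t (freeze t ω)) ⁻¹' {y} := by
    ext ω
    simp only [Set.mem_preimage, Set.mem_singleton_iff, Set.mem_ofPred_eq,
      runMax_congr (n := t) fun i hi => freeze_apply hi ω]
  rw [h]
  exact ((measurable_runMax t).comp (measurable_freeze_filt t)) (measurableSet_singleton y)

section
variable (hN : 1 ≤ N) (hr : ∀ x ≤ N, 0 ≤ r x ∧ r x ≤ 1)
include hN hr

/-- The candidate is adapted up to null sets: it is evaluated on the path frozen at time `t`. -/
lemma solution_freeze_ae_eq (s : Control N E) (t : ℕ) :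
    ∀ᵐ ω ∂(s.law ν), solution r s t (freeze t ω) = solution r s t ω := by
  filter_upwards [ae_isWalk ν hN s] with ω hω
  exact (solution_congr hr s (fun i hi => (freeze_apply hi ω).symm) (hω t)).symm

omit hN in
lemma measurable_solution_freeze (s : Control N E) (t : ℕ) :
    Measurable[filt N E t] fun ω => solution r s t (freeze t ω) :=
  (measurable_solution hr s t).comp (measurable_freeze_filt t)

omit hN in
lemma integrable_payoff (s : Control N E) : Integrable (payoff r) (s.law ν) :=
  integrable_of_mem_unitInterval (measurable_payoff r) (payoff_mem hr)

lemma condExp_le_solution_freeze (s : Control N E) (t : ℕ) :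
    ∀ᵐ ω ∂(s.law ν), ω ∈ (Set.univ : Set (Path N E)) →
      ((s.law ν)[payoff r | filt N E t]) ω ≤ solution r s t (freeze t ω) := by
  refine ae_le_on_of_setIntegral_le ((filt N E).le t) stronglyMeasurable_condExp.measurable
    (measurable_solution_freeze hr s t) integrable_condExp
    (integrable_of_mem_unitInterval ((measurable_solution_freeze hr s t).mono ((filt N E).le t)
      le_rfl) fun ω => solution_mem hr s t _) (@MeasurableSet.univ _ (filt N E t)) ?_
  intro A _ hA
  rw [setIntegral_condExp ((filt N E).le t) (integrable_payoff ν hr s) hA]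
  refine (setIntegral_payoff_le ν hN hr s hA).trans_eq (setIntegral_congr_ae
    ((filt N E).le t A hA) ?_)
  filter_upwards [solution_freeze_ae_eq ν hN hr s t] with ω hω _ using hω.symm

lemma le_condExp_nearOptControl {η : ℝ} (hη : 0 < η) (hη1 : η ≤ 1) (s₀ : Control N E)
    (t y : ℕ) :
    ∀ᵐ ω ∂((nearOptControl hr hη s₀ y).law ν), ω ∈ {ω : Path N E | runMax t ω = y} →
      ((growth N r η ^ 2)⁻¹) ^ (N - y) *
          solution r (nearOptControl hr hη s₀ y) t (freeze t ω) ≤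
        (((nearOptControl hr hη s₀ y).law ν)[payoff r | filt N E t]) ω := by
  set s := nearOptControl hr hη s₀ y with hs
  set c := (growth N r η ^ 2)⁻¹ with hc
  have hg := one_le_growth N r η
  have hc0 : 0 ≤ c := by positivity
  have hc1 : c ≤ 1 := inv_le_one_of_one_le₀ (one_le_pow₀ hg)
  refine ae_le_on_of_setIntegral_le ((filt N E).le t)
    ((measurable_solution_freeze hr s t).const_mul _) stronglyMeasurable_condExp.measurable
    ((integrable_of_mem_unitInterval ((measurable_solution_freeze hr s t).mono ((filt N E).le t)
      le_rfl) fun ω => solution_mem hr s t _).const_mul _) integrable_condExp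
    (measurableSet_runMax_filt t y) ?_
  intro A hAB hA
  rw [setIntegral_condExp ((filt N E).le t) (integrable_payoff ν hr s) hA]
  refine Eq.trans_le (setIntegral_congr_ae ((filt N E).le t A hA) ?_)
    (setIntegral_wsol_le_payoff ν hN hr s hc0 hc1 hA ?_)
  · filter_upwards [solution_freeze_ae_eq ν hN hr s t] with ω hω hωA
    have hM : runMax t ω = y := hAB hωA
    rw [hω, wsol, hM]
  · filter_upwards [ae_isWalk ν hN s] with ω hω hωA m hm hM
    have hMt : runMax t ω = y := hAB hωA
    refine nearOptControl_psiHat_le hr hη s₀ hη1 (hω m) ?_ hM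
    rw [← hMt]
    exact Finset.sup_mono (Finset.range_mono (by omega))

/-- On `{M_t = y}` the candidates of two controls with the same scale increments below `y` agree. -/
lemma solution_freeze_eq_of_constrained {s s₀ : Control N E} (hs : s ∈ constrained s₀ y) :
    ∀ᵐ ω ∂(s₀.law ν), ω ∈ {ω : Path N E | runMax t ω = y} →
      solution r s t (freeze t ω) = solution r s₀ t ω := by
  filter_upwards [solution_freeze_ae_eq ν hN hr s₀ t] with ω hω hy
  have hM : runMax t (freeze t ω) = y :=
    (runMax_congr (n := t) fun i hi => freeze_apply hi ω).trans hy
  rw [← hω]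
  exact solution_congr_control hr fun k hk => hs k (hM ▸ hk) _

omit hN hr in
lemma tendsto_growth (N : ℕ) (r : ℕ → ℝ) :
    Tendsto (fun k : ℕ => growth N r (1 / ((k : ℝ) + 1))) atTop (𝓝 1) := by
  have h0 : growth N r 0 = 1 := by simp [growth]
  have hc : Continuous (growth N r) := by unfold growth; fun_prop
  have h := (hc.tendsto 0).comp (tendsto_one_div_add_atTop_nhds_zero_nat (𝕜 := ℝ))
  rwa [h0] at h

lemma isEssSup_solution (s₀ : Control N E) (t y : ℕ) :
    IsEssSup ((s₀.law ν).restrict {ω | runMax t ω = y})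
      (fun s : constrained s₀ y => (s.1.law ν)[payoff r | filt N E t]) (solution r s₀ t) := by
  have hBt := measurableSet_runMax_filt (N := N) (E := E) t y
  have hB : MeasurableSet {ω : Path N E | runMax t ω = y} := (filt N E).le t _ hBt
  refine ⟨(measurable_solution hr s₀ t).aemeasurable, ?_, ?_⟩
  · rintro ⟨s, hs⟩
    refine (ae_restrict_iff' hB).2 ?_
    filter_upwards [ae_le_on_of_control ν s s₀ stronglyMeasurable_condExp.measurable
        (measurable_solution_freeze hr s t) (@MeasurableSet.univ _ (filt N E t))
        (condExp_le_solution_freeze ν hN hr s t),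
      solution_freeze_eq_of_constrained ν hN hr hs (t := t)] with ω h1 h2 hω
    exact (h1 (Set.mem_univ ω)).trans_eq (h2 hω)
  · intro Z _ hZ
    have hk : ∀ k : ℕ, ∀ᵐ ω ∂((s₀.law ν).restrict {ω | runMax t ω = y}),
        ((growth N r (1 / ((k : ℝ) + 1)) ^ 2)⁻¹) ^ (N - y) * solution r s₀ t ω ≤ Z ω := by
      intro k
      have hη : (0 : ℝ) < 1 / ((k : ℝ) + 1) := by positivity
      have hη1 : 1 / ((k : ℝ) + 1) ≤ 1 := by
        rw [div_le_one (by positivity)]; linarith [Nat.cast_nonneg (α := ℝ) k]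
      have hmem := nearOptControl_mem_constrained hr hη s₀ y
      filter_upwards [hZ ⟨_, hmem⟩, (ae_restrict_iff' hB).2
        (ae_le_on_of_control ν _ s₀ ((measurable_solution_freeze hr _ t).const_mul _)
          stronglyMeasurable_condExp.measurable hBt
          (le_condExp_nearOptControl ν hN hr hη hη1 s₀ t y)),
        (ae_restrict_iff' hB).2 (solution_freeze_eq_of_constrained ν hN hr hmem (t := t))]
        with ω h1 h2 h3
      rw [h3] at h2
      exact h2.trans h1
    filter_upwards [ae_all_iff.2 hk] with ω hω
    have hlim : Tendsto (fun k : ℕ =>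
        ((growth N r (1 / ((k : ℝ) + 1)) ^ 2)⁻¹) ^ (N - y) * solution r s₀ t ω) atTop
        (𝓝 (((1 ^ 2)⁻¹ : ℝ) ^ (N - y) * solution r s₀ t ω)) :=
      ((((tendsto_growth N r).pow 2).inv₀ (by norm_num)).pow _).mul_const _
    rw [one_pow, inv_one, one_pow, one_mul] at hlim
    exact le_of_tendsto' hlim hω

end

end

end Shuttle

theorem mainTheorem11 {E : Type*} [MeasurableSpace E]
    (ν : MeasureTheory.Measure E) [MeasureTheory.IsProbabilityMeasure ν]
    (N : ℕ) (hN : 1 ≤ N) (r : ℕ → ℝ) (hr : ∀ x ≤ N, 0 ≤ r x ∧ r x ≤ 1)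
    (s₀ : Shuttle.Control N E) :
    Shuttle.IsBellmanProcess ν r s₀ (Shuttle.solution r s₀) where
  adapted t := ⟨_, (Shuttle.measurable_solution_freeze hr s₀ t).stronglyMeasurable, by
    filter_upwards [Shuttle.solution_freeze_ae_eq ν hN hr s₀ t] with ω hω using hω.symm⟩
  isEssSup t y _ := Shuttle.isEssSup_solution ν hN hr s₀ t y
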